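/- **Setting.** A multiagent system $M$ consists of a finite set $Agt$ of agents, a finite set $S$ of states, a finite set $Act_i$ of local actions for each agent $i$ (with $Act=\prod_{i\in Agt}Act_i$ the set of joint actions), functions $L_i:S\to\mathcal P(Act_i)\setminus\{\emptyset\}$ giving the available actions, observation functions $O_i:S\to\mathcal O$ into a finite set $\mathcal O$ such that $O_i(s_1)=O_i(s_2)$ implies $L_i(s_1)=L_i(s_2)$, a nonempty set $I\subseteq S$ of initial states, a relation $T\subseteq S\times Act\times S$ such that for all $s\in S$, $a\in Act$ there is $s'$ with $(s,a,s')\in T$, and a map $\pi:S\to\mathcal P(Prop)$ with $Prop$ finite. A (dynamic) normative system on $M$ is a tuple $N=(Q,\delta_n,\delta_u,q_0)$ with a finite set $Q$ of normative states, $q_0\in Q$, $\delta_u:Q\times S\to Q$, and $\delta_n:S\times Q\to\mathcal P(Act)$ with $\delta_n(s,q)\subsetneq\prod_{i}L_i(s)$ for all $s,q$. The Kripke structure $K(N)$ has states $S\times Q$, initial states $I\times\{q_0\}$, and a transition from $(s_1,q_1)$ to $(s_2,q_2)$ iff $q_2=\delta_u(q_1,s_2)$ and there is $a\in Act\setminus\delta_n(s_1,q_1)$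 with $(s_1,a,s_2)\in T$. $Path(K(N))$ is the set of finite sequences of states of $K(N)$ that start in an initial state and follow transitions. **Problem $NC_1$.** Given are $M$, an observation function $O_x:S\to\mathcal O$ of a new agent $x$, and a finite indexed family $\Psi=(N_0,\dots,N_m)$ of normative systems on $M$, of which $N_0$ is the active one. For $\rho=(s_0,q_0)\cdots(s_l,q_l)$ put $|\rho|=l+1$ and $O_x(\rho)=O_x(s_0)\cdots O_x(s_l)$. The question is whether there is $k\in\mathbb N$ such that for every $\rho\in Path(K(N_0))$ with $|\rho|\ge k$, every $j\in\{0,\dots,m\}$ and every $\rho'\in Path(K(N_j))$ with $O_x(\rho')=O_x(\rho)$, one has $j=0$. **Theorem 2.** The problem $NC_1$ can be decided in polynomial time with respect to the sizes of the system and of $\Psi$. That is: encode an instance, with all its finite sets presented as initial segments of $\mathbb N$, by the complete list of the tables of $M$, $O_x$ and $N_0,\dots,N_m$, all numbers written in unary. Then the length of the encoding is bounded by a polynomial in $size(M)+size(\Psi)$, where $size(M)=|S|+|Act|+|Agt|+|\mathcal O|+|Prop|$ and $size(\Psi)=(m+1)+\sum_{j=0}^m|Q_j|$ ($Q_j$ being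 the set of normative states of $N_j$), and a (multi-stack) Turing machine decides $NC_1$ on all encoded instances in a number of steps that is bounded by a polynomial in the length of the encoding. -/

import Mathlib

namespace NormRecognition

/-- A multiagent system with agents `Agt`, environment states `S`, local actions `Act i` of agent
`i` (a joint action is an element of `∀ i, Act i`), observations `Obs` and atomic propositions
`AP`. Finiteness of these sets is imposed where problem instances are defined. -/
structure MultiagentSystem (Agt S : Type) (Act : Agt → Type) (Obs AP : Type) where
  /-- the local actions `L_i(s)` that are available to agent `i` at `s` -/
  avail : ∀ i : Agt, S → Set (Act i)
  avail_nonempty : ∀ i s, (avail i s).Nonempty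
  /-- the observation functions `O_i` of the agents -/
  obs : Agt → S → Obs
  /-- the initial states `I` -/
  initial : Set S
  initial_nonempty : initial.Nonempty
  /-- the transition relation `T`: `trans s a s'` means `(s, a, s') ∈ T` -/
  trans : S → (∀ i, Act i) → S → Prop
  trans_total : ∀ s a, ∃ s', trans s a s'
  /-- the interpretation `π` of the atomic propositions -/
  val : S → Set AP
  obs_avail : ∀ i s₁ s₂, obs i s₁ = obs i s₂ → avail i s₁ = avail i s₂

/-- A dynamic normative system on `M` with normative states `Q`. -/
structure NormativeSystem {Agt S : Type} {Act : Agt → Type} {Obs AP : Type}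
    (M : MultiagentSystem Agt S Act Obs AP) (Q : Type) where
  /-- `δ_n(s, q)`: the joint actions that are disallowed -/
  disallowed : S → Q → Set (∀ i, Act i)
  /-- `δ_u(q, s)`: the update of the normative state -/
  update : Q → S → Q
  /-- the initial normative state `q₀` -/
  start : Q
  /-- the available joint actions are never completely eliminated -/
  disallowed_ssubset : ∀ s q, disallowed s q ⊂ Set.univ.pi (fun i => M.avail i s)

/-- A Kripke structure with states `W` and atomic propositions `AP`. -/
structure Kripke (W AP : Type) where
  initial : Set W
  rel : W → W → Prop
  val : W → Set AP

/-- The finite paths of a Kripke structure that start in an initial state; the empty sequence is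
counted as a path as well. -/
def Kripke.Path {W AP : Type} (K : Kripke W AP) : Set (List W) :=
  {ρ | (∀ w ∈ ρ.head?, w ∈ K.initial) ∧ ρ.IsChain K.rel}

section Recognition

variable {Agt S : Type} {Act : Agt → Type} {Obs AP : Type}
  {M : MultiagentSystem Agt S Act Obs AP}

/-- The Kripke structure `K(N)`: the result of applying the normative system `N` on `M`. -/
def NormativeSystem.kripke {Q : Type} (N : NormativeSystem M Q) : Kripke (S × Q) AP where
  initial := {w | w.1 ∈ M.initial ∧ w.2 = N.start}
  rel w w' := (∃ a, M.trans w.1 a w'.1 ∧ a ∉ N.disallowed w.1 w.2) ∧ w'.2 = N.update w.2 w'.1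
  val w := M.val w.1

/-- The sequence of observations, under `Ox`, of a sequence of states of a structure `K(N)`. -/
def pathObs {Q : Type} (Ox : S → Obs) (ρ : List (S × Q)) : List Obs :=
  ρ.map (fun w => Ox w.1)

/-- The inverse of the observation function on paths, for a family `Ψ` of normative systems. A
path is recorded together with the index of the normative system that it belongs to. -/
def obsInverse {J : Type} {Q : J → Type} (Ox : S → Obs) (Ψ : ∀ j, NormativeSystem M (Q j))
    (o : List Obs) : Set (Σ j, List (S × Q j)) :=
  {ρ | ρ.2 ∈ (Ψ ρ.1).kripke.Path ∧ pathObs Ox ρ.2 = o}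

/-- The property asked for by the first norm recognition problem, for the observation function
`Ox` of the new agent, the family `Ψ` of normative systems and the active one among them, `Ψ j₀`:
from some length on, every path of `K(Ψ j₀)` is told apart by its observations from all paths of
the other members of the family. -/
def NC1 {J : Type} {Q : J → Type} (Ox : S → Obs) (Ψ : ∀ j, NormativeSystem M (Q j)) (j₀ : J) :
    Prop :=
  ∃ k : ℕ, ∀ ρ ∈ (Ψ j₀).kripke.Path, k ≤ ρ.length →
    ∀ ρ' ∈ obsInverse Ox Ψ (pathObs Ox ρ), ρ'.1 = j₀

end Recognition

/-- An instance of the first norm recognition problem. All finite sets are presented as sets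
`{0, …, n - 1}`; the active normative system has index `0`. -/
structure NC1Instance where
  numAgents : ℕ
  /-- the number of local actions of every agent -/
  numActs : Fin numAgents → ℕ
  numStates : ℕ
  numObs : ℕ
  numProps : ℕ
  sys : MultiagentSystem (Fin numAgents) (Fin numStates) (fun i => Fin (numActs i))
    (Fin numObs) (Fin numProps)
  /-- the observation function `O_x` of the new agent -/
  newObs : Fin numStates → Fin numObs
  /-- the number of normative systems other than the active one -/
  numOthers : ℕ
  /-- the number of normative states of every normative system -/
  numNorms : Fin (numOthers + 1) → ℕ
  norms : ∀ j, NormativeSystem sys (Fin (numNorms j))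

namespace NC1Instance

variable (P : NC1Instance)

/-- The number of joint actions. -/
def numJoint : ℕ := ∏ i, P.numActs i

/-- The size of the multiagent system. -/
def sysSize : ℕ := P.numStates + P.numJoint + P.numAgents + P.numObs + P.numProps

/-- The size of the set of normative systems: the number of the systems plus the number of all
normative states. -/
def normsSize : ℕ := (P.numOthers + 1) + ∑ j, P.numNorms j

open Classical in
/-- The truth value of a proposition as a number. -/
noncomputable def bit (p : Prop) : ℕ := if p then 1 else 0

/-- All joint actions, in a fixed order. -/
def jointActions : List (∀ i, Fin (P.numActs i)) :=
  (List.finRange (∏ i, P.numActs i)).map finPiFinEquiv.symm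

/-- The complete table of the multiagent system and of the observations of the new agent, as a
list of numbers. -/
noncomputable def sysTable : List ℕ :=
  [P.numAgents] ++ List.ofFn P.numActs ++ [P.numStates, P.numObs, P.numProps] ++
  ((List.finRange P.numAgents).flatMap fun i => (List.finRange P.numStates).flatMap fun s =>
    (List.finRange (P.numActs i)).map fun a => bit (a ∈ P.sys.avail i s)) ++
  ((List.finRange P.numAgents).flatMap fun i => (List.finRange P.numStates).map fun s =>
    (P.sys.obs i s : ℕ)) ++
  ((List.finRange P.numStates).map fun s => bit (s ∈ P.sys.initial)) ++
  ((List.finRange P.numStates).flatMap fun s => P.jointActions.flatMap fun a =>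
    (List.finRange P.numStates).map fun s' => bit (P.sys.trans s a s')) ++
  ((List.finRange P.numStates).flatMap fun s => (List.finRange P.numProps).map fun p =>
    bit (p ∈ P.sys.val s)) ++
  ((List.finRange P.numStates).map fun s => (P.newObs s : ℕ))

/-- The complete table of the normative system with index `j`, as a list of numbers. -/
noncomputable def normTable (j : Fin (P.numOthers + 1)) : List ℕ :=
  [P.numNorms j, ((P.norms j).start : ℕ)] ++
  ((List.finRange P.numStates).flatMap fun s => (List.finRange (P.numNorms j)).flatMap fun q =>
    P.jointActions.map fun a => bit (a ∈ (P.norms j).disallowed s q)) ++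
  ((List.finRange (P.numNorms j)).flatMap fun q => (List.finRange P.numStates).map fun s =>
    ((P.norms j).update q s : ℕ))

/-- The encoding of a list of numbers as a word over a two-letter alphabet: each number is written
in unary and closed by the letter `false`. -/
def encodeNats (l : List ℕ) : List Bool :=
  l.flatMap fun n => List.replicate n true ++ [false]

/-- The encoding of an instance as a word: all its tables, listed in full. -/
noncomputable def encode : List Bool :=
  encodeNats (P.sysTable ++ [P.numOthers] ++
    (List.finRange (P.numOthers + 1)).flatMap P.normTable)

open Classical in
/-- The correct answer to an instance. -/
noncomputable def answer : Bool :=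
  decide (NC1 P.newObs P.norms 0)

end NC1Instance

end NormRecognition

/-! The answer is negative exactly if, for some `j ≠ 0`, there are arbitrarily long pairs of paths
of `K(N_0)` and `K(N_j)` with equal observations. Such a pair is a path in the product of the two
structures, restricted to pairs of states with equal `O_x`, that starts at a pair of initial states.
In this finite graph with `d` vertices, delete repeatedly all vertices without a successor. After
`d` rounds nothing changes any more (`survivors_core`). Every vertex that is left has a successor
that is left, hence starts paths of every length (`exists_paths_of_mem_core`); a vertex that starts
a path of `d` steps survives all `d` rounds (`mem_iterate_survivors`). So the answer is positive
iff, for every `j ≠ 0`, no pair of initial states is left (`decideNC1_table`).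

For the running time, structured programs on four stacks are compiled to multi-stack machines with
the same step count (`Exec.runs`, `polyTime_of_exec`). `PolyFun` is the class of functions that such
programs compute in polynomial time on values coded as binary trees. It is closed under composition,
pairing, case distinction and loops whose states stay polynomially bounded (`PolyFun.while_loop`),
hence under the usual operations on lists and unary numbers. The deletion procedure is written with
these operations on the list of all tables, so that `fun_prop` derives most of its time bound from
the closure properties.

The length of the encoding is a separate count: the tables have cubically many entries
(`length_table_le`), and each entry is at most the size of the instance (`le_of_mem_table`). -/

namespace StackProgram

/-! ### Structured stack programs and their translation to multi-stack machines -/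

open Turing

/-- The contents of the four stacks. -/
abbrev Store := Fin 4 → List Bool

/-- Structured programs that work on four stacks of bits. -/
inductive Cmd
  | skip
  | push (k : Fin 4) (b : Bool)
  | seq (c d : Cmd)
  /-- pop the stack `k` and continue according to the outcome: empty, `false`, `true` -/
  | case (k : Fin 4) (e f t : Cmd)
  /-- pop the stack `k`, run `f` or `t` according to the bit found, repeat until `k` is empty -/
  | loop (k : Fin 4) (f t : Cmd)

open Function in
/-- `Exec c s s' n`: the program `c` transforms the store `s` into `s'` in at most `n` steps. -/
inductive Exec : Cmd → Store → Store → ℕ → Prop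
  | skip {s n} : 1 ≤ n → Exec .skip s s n
  | push {k b s n} : 1 ≤ n → Exec (.push k b) s (update s k (b :: s k)) n
  | seq {c d s s' s'' m n l} : Exec c s s' m → Exec d s' s'' n → m + n ≤ l →
      Exec (.seq c d) s s'' l
  | case_nil {k e f t s s' m n} : s k = [] → Exec e s s' m → m + 1 ≤ n →
      Exec (.case k e f t) s s' n
  | case_false {k e f t s s' l m n} : s k = false :: l → Exec f (update s k l) s' m → m + 1 ≤ n →
      Exec (.case k e f t) s s' n
  | case_true {k e f t s s' l m n} : s k = true :: l → Exec t (update s k l) s' m → m + 1 ≤ n →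
      Exec (.case k e f t) s s' n
  | loop_nil {k f t s n} : s k = [] → 1 ≤ n → Exec (.loop k f t) s s n
  | loop_false {k f t s s' s'' l m m' n} : s k = false :: l → Exec f (update s k l) s' m →
      Exec (.loop k f t) s' s'' m' → m + m' + 1 ≤ n → Exec (.loop k f t) s s'' n
  | loop_true {k f t s s' s'' l m m' n} : s k = true :: l → Exec t (update s k l) s' m →
      Exec (.loop k f t) s' s'' m' → m + m' + 1 ≤ n → Exec (.loop k f t) s s'' n

theorem Exec.mono {c s s' m n} (h : Exec c s s' m) (hmn : m ≤ n) : Exec c s s' n := by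
  cases h with
  | skip h => exact .skip (h.trans hmn)
  | push h => exact .push (h.trans hmn)
  | seq h₁ h₂ h => exact .seq h₁ h₂ (h.trans hmn)
  | case_nil hs h₁ h => exact .case_nil hs h₁ (h.trans hmn)
  | case_false hs h₁ h => exact .case_false hs h₁ (h.trans hmn)
  | case_true hs h₁ h => exact .case_true hs h₁ (h.trans hmn)
  | loop_nil hs h => exact .loop_nil hs (h.trans hmn)
  | loop_false hs h₁ h₂ h => exact .loop_false hs h₁ h₂ (h.trans hmn)
  | loop_true hs h₁ h₂ h => exact .loop_true hs h₁ h₂ (h.trans hmn)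

/-- The program labels of a structured program. -/
def Label : Cmd → Type
  | .skip => Unit
  | .push _ _ => Unit
  | .seq c d => Label c ⊕ Label d
  | .case _ e f t => Option (Label e ⊕ Label f ⊕ Label t)
  | .loop _ f t => Option (Label f ⊕ Label t)

instance Label.fintype : ∀ c, Fintype (Label c)
  | .skip => inferInstanceAs (Fintype Unit)
  | .push _ _ => inferInstanceAs (Fintype Unit)
  | .seq c d =>
    haveI := fintype c; haveI := fintype d
    inferInstanceAs (Fintype (Label c ⊕ Label d))
  | .case _ e f t =>
    haveI := fintype e; haveI := fintype f; haveI := fintype t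
    inferInstanceAs (Fintype (Option (Label e ⊕ Label f ⊕ Label t)))
  | .loop _ f t =>
    haveI := fintype f; haveI := fintype t
    inferInstanceAs (Fintype (Option (Label f ⊕ Label t)))

/-- The label at which the execution of a program begins. -/
def Label.first : ∀ c, Label c
  | .skip => ()
  | .push _ _ => ()
  | .seq c _ => Sum.inl (first c)
  | .case _ _ _ _ => none
  | .loop _ _ _ => none

/-- Statements of the machines that programs are translated to. The internal state remembers the
outcome of the last pop. -/
abbrev MachineStmt (Λ : Type) := TM2.Stmt (fun _ : Fin 4 => Bool) Λ (Option Bool)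

/-- Pop the stack `k` and jump according to the outcome. -/
def popJump {Λ : Type} (k : Fin 4) (e f t : Λ) : MachineStmt Λ :=
  .pop k (fun _ x => x) (.goto fun x => x.elim e fun b => cond b t f)

/-- The machine code of a program whose labels are placed at `emb` and that jumps to `next` in
the end. -/
def machineCode {Λ : Type} : ∀ c, (Label c → Λ) → Λ → Label c → MachineStmt Λ
  | .skip, _, next => fun _ => .goto fun _ => next
  | .push k b, _, next => fun _ => .push k (fun _ => b) (.goto fun _ => next)
  | .seq c d, emb, next => Sum.elim
      (machineCode c (emb ∘ Sum.inl) (emb (Sum.inr (.first d))))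
      (machineCode d (emb ∘ Sum.inr) next)
  | .case k e f t, emb, next => fun l => l.elim
      (popJump k (emb (some (Sum.inl (.first e)))) (emb (some (Sum.inr (Sum.inl (.first f)))))
        (emb (some (Sum.inr (Sum.inr (.first t))))))
      (Sum.elim (machineCode e (emb ∘ some ∘ Sum.inl) next)
        (Sum.elim (machineCode f (emb ∘ some ∘ Sum.inr ∘ Sum.inl) next)
          (machineCode t (emb ∘ some ∘ Sum.inr ∘ Sum.inr) next)))
  | .loop k f t, emb, next => fun l => l.elim
      (popJump k next (emb (some (Sum.inl (.first f)))) (emb (some (Sum.inr (.first t)))))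
      (Sum.elim (machineCode f (emb ∘ some ∘ Sum.inl) (emb none))
        (machineCode t (emb ∘ some ∘ Sum.inr) (emb none)))

section Run

variable {Λ : Type} (m : Λ → MachineStmt Λ)

/-- The machine gets from the label `l` and the store `s` to `l'` and `s'` in at most `n` steps,
whatever the internal state is. -/
def Runs (l : Λ) (s : Store) (l' : Λ) (s' : Store) (n : ℕ) : Prop :=
  ∀ v, ∃ v', ∃ i ≤ n, (flip bind (TM2.step m))^[i] (some ⟨some l, v, s⟩) = some ⟨some l', v', s'⟩

variable {m}

theorem Runs.trans {l s l' s' l'' s'' a b n} (h₁ : Runs m l s l' s' a)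
    (h₂ : Runs m l' s' l'' s'' b) (hn : a + b ≤ n) : Runs m l s l'' s'' n := by
  intro v
  obtain ⟨v', i, hi, h⟩ := h₁ v
  obtain ⟨v'', j, hj, h'⟩ := h₂ v'
  exact ⟨v'', j + i, by omega, by rw [Function.iterate_add_apply, h, h']⟩

theorem Runs.of_step {l s l' s' n} (hn : 1 ≤ n)
    (h : ∀ v, ∃ v', TM2.stepAux (m l) v s = ⟨some l', v', s'⟩) : Runs m l s l' s' n := by
  intro v
  obtain ⟨v', h⟩ := h v
  refine ⟨v', 1, hn, ?_⟩
  simp [flip, TM2.step, h]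

theorem Runs.popJump_nil {l k e f t s} (hm : m l = popJump k e f t) (hs : s k = []) :
    Runs m l s e s 1 := by
  refine .of_step le_rfl fun v => ⟨none, ?_⟩
  rw [hm]
  simp [popJump, hs]

theorem Runs.popJump_cons {l k e f t s b r} (hm : m l = popJump k e f t) (hs : s k = b :: r) :
    Runs m l s (cond b t f) (Function.update s k r) 1 := by
  refine .of_step le_rfl fun v => ⟨some b, ?_⟩
  rw [hm]
  simp [popJump, hs]

/-- Induction on the execution. A machine statement ends with its own jump, so every program step
costs one machine step and sequencing costs nothing. The embedding of the labels and the exit label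
are arbitrary because a subprogram occupies part of the labels of the whole; the exit label of a
loop body is the head of the loop. -/
theorem Exec.runs {c s s' n} (h : Exec c s s' n) :
    ∀ (emb : Label c → Λ) (next : Λ), (∀ l, m (emb l) = machineCode c emb next l) →
      Runs m (emb (.first c)) s next s' n := by
  induction h with
  | skip h =>
    intro emb next hm
    exact .of_step h fun v => ⟨v, by rw [hm]; rfl⟩
  | push h =>
    intro emb next hm
    exact .of_step h fun v => ⟨v, by rw [hm]; rfl⟩
  | seq _ _ h ih₁ ih₂ =>
    intro emb next hm
    exact (ih₁ (emb ∘ Sum.inl) _ fun l => hm (Sum.inl l)).trans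
      (ih₂ (emb ∘ Sum.inr) next fun l => hm (Sum.inr l)) h
  | case_nil hs _ h ih =>
    intro emb next hm
    exact (Runs.popJump_nil (hm none) hs).trans
      (ih (emb ∘ some ∘ Sum.inl) next fun l => hm (some (Sum.inl l))) (by omega)
  | case_false hs _ h ih =>
    intro emb next hm
    exact (Runs.popJump_cons (hm none) hs).trans
      (ih (emb ∘ some ∘ Sum.inr ∘ Sum.inl) next fun l => hm (some (Sum.inr (Sum.inl l))))
      (by omega)
  | case_true hs _ h ih =>
    intro emb next hm
    exact (Runs.popJump_cons (hm none) hs).trans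
      (ih (emb ∘ some ∘ Sum.inr ∘ Sum.inr) next fun l => hm (some (Sum.inr (Sum.inr l))))
      (by omega)
  | loop_nil hs h =>
    intro emb next hm v
    obtain ⟨v', i, hi, h'⟩ := Runs.popJump_nil (hm none) hs v
    exact ⟨v', i, hi.trans h, h'⟩
  | loop_false hs _ _ h ih₁ ih₂ =>
    intro emb next hm
    exact ((Runs.popJump_cons (hm none) hs).trans
      (ih₁ (emb ∘ some ∘ Sum.inl) _ fun l => hm (some (Sum.inl l))) le_rfl).trans
      (ih₂ emb next hm) (by omega)
  | loop_true hs _ _ h ih₁ ih₂ =>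
    intro emb next hm
    exact ((Runs.popJump_cons (hm none) hs).trans
      (ih₁ (emb ∘ some ∘ Sum.inr) _ fun l => hm (some (Sum.inr l))) le_rfl).trans
      (ih₂ emb next hm) (by omega)

end Run

/-- The machine that runs a program on the contents of the stack `0` and then halts. -/
def machine (c : Cmd) : FinTM2 where
  K := Fin 4
  k₀ := 0
  k₁ := 0
  Γ _ := Bool
  Λ := Option (Label c)
  main := some (.first c)
  σ := Option Bool
  initialState := none
  Γk₀Fin := inferInstanceAs (Fintype Bool)
  m l := l.elim (.load (fun _ => none) .halt) (machineCode c some none)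

/-- The store with the word `l` on the stack `0` and nothing else. -/
def single (l : List Bool) : Store := ![l, [], [], []]

theorem initList_machine (c : Cmd) (l : List Bool) :
    initList (machine c) l = ⟨some (some (.first c)), none, single l⟩ := by
  unfold initList
  congr 1
  funext k
  change Fin 4 at k
  fin_cases k <;> rfl

theorem haltList_machine (c : Cmd) (l : List Bool) :
    haltList (machine c) l = ⟨none, none, single l⟩ := by
  unfold haltList
  congr 1
  funext k
  change Fin 4 at k
  fin_cases k <;> rfl

/-- The additional step is spent at the exit label `none`, where the internal state is reset, as
`haltList` demands, before the machine halts. -/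
theorem machine_outputs {c : Cmd} {l l' : List Bool} {n : ℕ}
    (h : Exec c (single l) (single l') n) :
    Nonempty (TM2OutputsInTime (machine c) l (some l') (n + 1)) := by
  obtain ⟨v, i, hi, hr⟩ := h.runs (m := (machine c).m) some none (fun l => rfl) none
  have he : (flip bind (machine c).step)^[1 + i] (some (initList (machine c) l)) =
      some (haltList (machine c) l') := by
    rw [initList_machine, haltList_machine, Function.iterate_add_apply]
    exact congrArg (flip bind (machine c).step) hr
  exact ⟨⟨⟨1 + i, he⟩, (by omega : 1 + i ≤ n + 1)⟩⟩

/-- A function on words that some program computes within a polynomial number of steps is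
computable in polynomial time by a multi-stack machine. -/
theorem polyTime_of_exec {α β : Type} {ea : α → List Bool} {eb : β → List Bool} {f : α → β}
    (c : Cmd) (p : Polynomial ℕ)
    (h : ∀ a, Exec c (single (ea a)) (single (eb (f a))) (p.eval (ea a).length)) :
    Nonempty (TM2ComputableInPolyTime ea eb f) :=
  ⟨{ tm := machine c
     inputAlphabet := Equiv.refl Bool
     outputAlphabet := Equiv.refl Bool
     time := p + 1
     outputsFun := fun a => by
      have h' := (machine_outputs (h a)).some
      have e₁ : List.map (Equiv.refl Bool).invFun (ea a) = ea a := List.map_id _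
      have e₂ : List.map (Equiv.refl Bool).invFun (eb (f a)) = eb (f a) := List.map_id _
      rw [Polynomial.eval_add, Polynomial.eval_one]
      exact e₁.symm ▸ e₂.symm ▸ h' }⟩

end StackProgram

/-! ### Binary trees on a stack: copying, exchanging and removing them -/

namespace StackProgram

/-- Binary trees: the values that programs work on. -/
inductive BinTree
  | leaf
  | node (l r : BinTree)

/-- The prefix code of a tree. -/
def BinTree.word : BinTree → List Bool
  | leaf => [false]
  | node l r => true :: (l.word ++ r.word)

/-- A representation of the elements of a type by trees. -/
class Code (α : Type) where
  tree : α → BinTree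

/-- The word that represents an element on a stack. -/
def word {α : Type} [Code α] (a : α) : List Bool := (Code.tree a).word

/-- The length of the word that represents an element. -/
def size {α : Type} [Code α] (a : α) : ℕ := (word a).length

section Store

/-- The store with the given stacks. -/
def quad (a b c d : List Bool) : Store := ![a, b, c, d]

variable (a b c d x : List Bool)

@[simp] theorem quad_zero : quad a b c d 0 = a := rfl
@[simp] theorem quad_one : quad a b c d 1 = b := rfl
@[simp] theorem quad_two : quad a b c d 2 = c := rfl
@[simp] theorem quad_three : quad a b c d 3 = d := rfl

@[simp] theorem update_quad_zero :
    Function.update (quad a b c d) 0 x = quad x b c d := by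
  funext i; fin_cases i <;> rfl

@[simp] theorem update_quad_one :
    Function.update (quad a b c d) 1 x = quad a x c d := by
  funext i; fin_cases i <;> rfl

@[simp] theorem update_quad_two :
    Function.update (quad a b c d) 2 x = quad a b x d := by
  funext i; fin_cases i <;> rfl

@[simp] theorem update_quad_three :
    Function.update (quad a b c d) 3 x = quad a b c x := by
  funext i; fin_cases i <;> rfl

theorem single_eq_quad (l : List Bool) : single l = quad l [] [] [] := rfl

end Store

theorem Exec.then {c d s s' s'' m n} (h : Exec c s s' m) (h' : Exec d s' s'' n) :
    Exec (.seq c d) s s'' (m + n) := .seq h h' le_rfl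

theorem exec_push (k : Fin 4) (b : Bool) (s : Store) :
    Exec (.push k b) s (Function.update s k (b :: s k)) 1 := .push le_rfl

/-- Move the stack `j` to the top of the stack `k`, which reverses it. -/
def pour (j k : Fin 4) : Cmd := .loop j (.push k false) (.push k true)

theorem exec_pour {j k : Fin 4} (hjk : j ≠ k) (l : List Bool) : ∀ s : Store, s j = l →
    Exec (pour j k) s (Function.update (Function.update s j []) k (l.reverse ++ s k))
      (2 * l.length + 1) := by
  induction l with
  | nil =>
    intro s hs
    have : Function.update (Function.update s j []) k (List.reverse [] ++ s k) = s := by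
      simp [show Function.update s j [] = s by simp [hs]]
    rw [this]
    exact .loop_nil hs le_rfl
  | cons b l ih =>
    intro s hs
    have h := ih (Function.update (Function.update s j l) k (b :: s k))
      (by simp [Function.update_of_ne hjk])
    have e : Function.update (Function.update (Function.update (Function.update s j l) k (b :: s k))
        j []) k (l.reverse ++ Function.update (Function.update s j l) k (b :: s k) k) =
        Function.update (Function.update s j []) k ((b :: l).reverse ++ s k) := by
      funext i
      by_cases hi : i = k
      · subst hi; simp
      · by_cases hi' : i = j
        · subst hi'; simp [hi]
        · simp [hi, hi']
    rw [e] at h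
    have hp := exec_push k b (Function.update s j l)
    rw [Function.update_of_ne hjk.symm] at hp
    cases b
    · exact .loop_false hs hp h (by simp; omega)
    · exact .loop_true hs hp h (by simp; omega)

/-- Move the tree on top of the stack `0` to the stack `1`, which reverses it. -/
def takeTree : Cmd := .seq (.push 3 true) (.loop 3 .skip
  (.case 0 .skip (.push 1 false) (.seq (.push 1 true) (.seq (.push 3 true) (.push 3 true)))))

/-- Stack `3` counts the trees still to be read: a leaf settles one of them, a node replaces one by
two. Since the code is prefix-free, the count tells where the tree ends. The statement extends a
given execution of the rest of the loop backwards, so the induction treats the right subtree first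
and then the left one. -/
theorem exec_takeTree_loop (t : BinTree) : ∀ (r b c d : List Bool) (s : Store) (n : ℕ),
    Exec (.loop 3 .skip (.case 0 .skip (.push 1 false)
      (.seq (.push 1 true) (.seq (.push 3 true) (.push 3 true)))))
      (quad r (t.word.reverse ++ b) c d) s n →
    Exec (.loop 3 .skip (.case 0 .skip (.push 1 false)
      (.seq (.push 1 true) (.seq (.push 3 true) (.push 3 true)))))
      (quad (t.word ++ r) b c (true :: d)) s (n + 5 * t.word.length) := by
  induction t with
  | leaf =>
    intro r b c d s n h
    refine .loop_true (quad_three ..) ?_ h (show 2 + n + 1 ≤ _ by simp [BinTree.word]; omega)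
    refine .case_false (l := r) (by simp [BinTree.word]) (m := 1) ?_ le_rfl
    simpa [BinTree.word] using exec_push 1 false (quad r b c d)
  | node t₁ t₂ ih₁ ih₂ =>
    intro r b c d s n h
    have h₂ := ih₁ (t₂.word ++ r) (true :: b) c (true :: d) s _
      (ih₂ r (t₁.word.reverse ++ true :: b) c d s n
        (by simpa [BinTree.word] using h))
    refine .loop_true (quad_three ..) ?_ h₂ (show 4 + _ + 1 ≤ _ by simp [BinTree.word]; omega)
    refine .case_true (l := t₁.word ++ (t₂.word ++ r)) (by simp [BinTree.word]) (m := 3) ?_ le_rfl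
    simpa using (exec_push 1 true (quad (t₁.word ++ (t₂.word ++ r)) b c d)).then
      ((exec_push 3 true _).then (exec_push 3 true _))

theorem exec_takeTree (t : BinTree) (r b c : List Bool) :
    Exec takeTree (quad (t.word ++ r) b c []) (quad r (t.word.reverse ++ b) c [])
      (5 * t.word.length + 2) := by
  have h := exec_takeTree_loop t r b c [] _ 1 (.loop_nil (by simp) le_rfl)
  have h' := exec_push 3 true (quad (t.word ++ r) b c [])
  simp only [quad_three, update_quad_three] at h'
  exact (h'.then h).mono (by omega)

/-- Duplicate the tree on top of the stack `0`. -/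
def dup : Cmd := .seq takeTree (.seq
  (.loop 1 (.seq (.push 0 false) (.push 2 false)) (.seq (.push 0 true) (.push 2 true)))
  (.seq (pour 2 1) (pour 1 0)))

theorem exec_split (l : List Bool) : ∀ a c : List Bool,
    Exec (.loop 1 (.seq (.push 0 false) (.push 2 false)) (.seq (.push 0 true) (.push 2 true)))
      (quad a l c []) (quad (l.reverse ++ a) [] (l.reverse ++ c) []) (3 * l.length + 1) := by
  induction l with
  | nil => intro a c; exact .loop_nil (by simp) le_rfl
  | cons b l ih =>
    intro a c
    have h := ih (b :: a) (b :: c)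
    have hp := (exec_push 0 b (quad a l c [])).then (exec_push 2 b _)
    simp only [quad_zero, update_quad_zero, quad_two, update_quad_two] at hp
    rw [List.reverse_cons, List.append_assoc, List.append_assoc]
    cases b
    · exact .loop_false (l := l) (by simp) (by simpa using hp) h (by simp; omega)
    · exact .loop_true (l := l) (by simp) (by simpa using hp) h (by simp; omega)

/-- The reversed copy on stack `1` is split into upright copies on the stacks `0` and `2`. The
second one returns through stack `1`, because a single move would reverse it. -/
theorem exec_dup (t : BinTree) (r : List Bool) :
    Exec dup (single (t.word ++ r)) (single (t.word ++ (t.word ++ r)))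
      (12 * t.word.length + 5) := by
  have h₁ := exec_takeTree t r [] []
  have h₂ := exec_split (t.word.reverse ++ []) r []
  have h₃ := exec_pour (j := 2) (k := 1) (by decide) t.word
    (quad (t.word ++ r) [] t.word []) (by simp)
  have h₄ := exec_pour (j := 1) (k := 0) (by decide) t.word.reverse
    (quad (t.word ++ r) t.word.reverse [] []) (by simp)
  simp only [quad_zero, update_quad_zero, update_quad_two, quad_one, update_quad_one,
    List.append_nil, List.reverse_reverse, List.length_reverse] at h₁ h₂ h₃ h₄
  exact (h₁.then (h₂.then (h₃.then h₄))).mono (by omega)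

/-- Exchange the two trees on top of the stack `0`. -/
def exch : Cmd := .seq takeTree (.seq (pour 1 2) (.seq takeTree
  (.seq (pour 2 3) (.seq (pour 3 0) (pour 1 0)))))

/-- The first tree is parked on stack `2` while the second is read, as `takeTree` needs stack `3`
for counting. It then makes a detour through stack `3`, so that it is reversed an even number of
times in all. -/
theorem exec_exch (t u : BinTree) (r : List Bool) :
    Exec exch (single (t.word ++ (u.word ++ r))) (single (u.word ++ (t.word ++ r)))
      (11 * t.word.length + 7 * u.word.length + 8) := by
  have h₁ := exec_takeTree t (u.word ++ r) [] []
  have h₂ := exec_pour (j := 1) (k := 2) (by decide) t.word.reverse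
    (quad (u.word ++ r) t.word.reverse [] []) (by simp)
  have h₃ := exec_takeTree u r [] t.word
  have h₄ := exec_pour (j := 2) (k := 3) (by decide) t.word
    (quad r u.word.reverse t.word []) (by simp)
  have h₅ := exec_pour (j := 3) (k := 0) (by decide) t.word.reverse
    (quad r u.word.reverse [] t.word.reverse) (by simp)
  have h₆ := exec_pour (j := 1) (k := 0) (by decide) u.word.reverse
    (quad (t.word ++ r) u.word.reverse [] []) (by simp)
  simp only [quad_zero, update_quad_zero, quad_two, update_quad_two,
    update_quad_one, quad_three, update_quad_three, List.append_nil, List.reverse_reverse,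
    List.length_reverse] at h₁ h₂ h₃ h₄ h₅ h₆
  exact (h₁.then (h₂.then (h₃.then (h₄.then (h₅.then h₆))))).mono (by omega)

theorem exec_clear (l : List Bool) (k : Fin 4) : ∀ s : Store, s k = l →
    Exec (.loop k .skip .skip) s (Function.update s k []) (2 * l.length + 1) := by
  induction l with
  | nil =>
    intro s hs
    have : Function.update s k [] = s := by rw [← hs]; simp
    rw [this]
    exact .loop_nil hs le_rfl
  | cons b l ih =>
    intro s hs
    have h := ih (Function.update s k l) (by simp)
    rw [Function.update_idem] at h
    cases b
    · exact .loop_false hs (.skip le_rfl) h (by simp; omega)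
    · exact .loop_true hs (.skip le_rfl) h (by simp; omega)

/-- Remove the tree on top of the stack `0`. -/
def drop : Cmd := .seq takeTree (.loop 1 .skip .skip)

theorem exec_drop (t : BinTree) (r : List Bool) :
    Exec drop (single (t.word ++ r)) (single r) (7 * t.word.length + 3) := by
  have h₁ := exec_takeTree t r [] []
  have h₂ := exec_clear t.word.reverse 1 (quad r t.word.reverse [] []) (by simp)
  simp only [update_quad_one, List.append_nil, List.length_reverse] at h₁ h₂
  exact (h₁.then h₂).mono (by omega)

/-- Remove the bit on top of the stack `0`. -/
def pop : Cmd := .case 0 .skip .skip .skip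

theorem exec_pop (b : Bool) (r : List Bool) : Exec pop (single (b :: r)) (single r) 2 := by
  cases b
  · exact .case_false (l := r) rfl
      (by simpa [single_eq_quad] using Exec.skip (s := quad r [] [] []) le_rfl) le_rfl
  · exact .case_true (l := r) rfl
      (by simpa [single_eq_quad] using Exec.skip (s := quad r [] [] []) le_rfl) le_rfl

theorem exec_push_single (b : Bool) (r : List Bool) :
    Exec (.push 0 b) (single r) (single (b :: r)) 1 := by
  simpa [single_eq_quad] using exec_push 0 b (quad r [] [] [])

/-- Push a word to the stack `0`. -/
def pushWord : List Bool → Cmd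
  | [] => .skip
  | b :: l => .seq (pushWord l) (.push 0 b)

theorem exec_pushWord (l r : List Bool) :
    Exec (pushWord l) (single r) (single (l ++ r)) (l.length + 1) := by
  induction l with
  | nil => exact .skip le_rfl
  | cons b l ih => exact (ih.then (exec_push_single b _))

end StackProgram

/-! ### Functions computed by programs in polynomial time -/

namespace StackProgram

theorem eval_mono (p : Polynomial ℕ) {m n : ℕ} (h : m ≤ n) : p.eval m ≤ p.eval n := by
  rw [Polynomial.eval_eq_sum, Polynomial.eval_eq_sum]
  exact Finset.sum_le_sum fun i _ => Nat.mul_le_mul_left _ (Nat.pow_le_pow_left h i)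

instance : Code Unit := ⟨fun _ => .leaf⟩

instance : Code Bool := ⟨fun b => cond b (.node .leaf .leaf) .leaf⟩

/-- Unary, with the same tree as a list of `n` units. Likewise a nonempty list has the tree of the
pair of its head and tail. Conversions between these forms therefore need no computation, by
`PolyFun.of_tree_eq`. -/
instance : Code ℕ := ⟨fun n => Nat.rec .leaf (fun _ t => .node .leaf t) n⟩

instance {α β : Type} [Code α] [Code β] : Code (α × β) :=
  ⟨fun a => .node (Code.tree a.1) (Code.tree a.2)⟩

instance {α : Type} [Code α] : Code (List α) :=
  ⟨fun l => l.foldr (fun a t => .node (Code.tree a) t) .leaf⟩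

section Size

variable {α β : Type} [Code α] [Code β]

theorem word_pair (a : α) (b : β) : word (a, b) = true :: (word a ++ word b) := rfl
theorem word_cons (a : α) (l : List α) : word (a :: l) = true :: (word a ++ word l) := rfl

@[simp] theorem size_pair (a : α) (b : β) : size (a, b) = 1 + size a + size b := by
  simp [size, word_pair]; omega

@[simp] theorem size_nil : size ([] : List α) = 1 := rfl

@[simp] theorem size_cons (a : α) (l : List α) : size (a :: l) = 1 + size a + size l := by
  simp [size, word_cons]; omega

@[simp] theorem size_nat (n : ℕ) : size n = 2 * n + 1 := by
  induction n with
  | zero => rfl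
  | succ n ih =>
    have : size (n + 1) = 2 + size n := by
      simp [size, word, Code.tree, BinTree.word]; omega
    omega

theorem size_bool_le (b : Bool) : size b ≤ 3 := by cases b <;> decide

theorem size_append (l m : List α) : size (l ++ m) + 1 = size l + size m := by
  induction l with
  | nil => simp; omega
  | cons a l ih => simp; omega

theorem length_lt_size (l : List α) : l.length < size l := by
  induction l with
  | nil => simp
  | cons a l ih => simp; omega

theorem size_le_of_mem {a : α} {l : List α} (h : a ∈ l) : size a ≤ size l := by
  induction l with
  | nil => simp at h
  | cons b l ih =>
    rcases List.mem_cons.1 h with rfl | h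
    · simp; omega
    · have := ih h; simp; omega

theorem size_le_of_sublist {l m : List α} (h : l.Sublist m) : size l ≤ size m := by
  induction h with
  | slnil => exact le_rfl
  | cons a _ ih => simp; omega
  | cons_cons a _ ih => simp; omega

theorem size_le_of_forall {l : List α} {b : ℕ} (h : ∀ a ∈ l, size a ≤ b) :
    size l ≤ 1 + l.length * (1 + b) := by
  induction l with
  | nil => simp
  | cons a l ih =>
    have h₁ := h a (by simp)
    have h₂ := ih fun x hx => h x (by simp [hx])
    simp only [size_cons, List.length_cons, Nat.add_mul, one_mul]
    omega

end Size

/-- The functions that some program computes in place, on top of the stack `0`, within a number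
of steps that is polynomial in the size of the argument. -/
@[fun_prop]
def PolyFun {α β : Type} [Code α] [Code β] (f : α → β) : Prop :=
  ∃ (c : Cmd) (p : Polynomial ℕ), ∀ a, size (f a) ≤ p.eval (size a) ∧
    ∀ r, Exec c (single (word a ++ r)) (single (word (f a) ++ r)) (p.eval (size a))

/-- A quantity that is bounded by a polynomial in the size of the argument. -/
def PolyBounded {α : Type} [Code α] (u : α → ℕ) : Prop :=
  ∃ p : Polynomial ℕ, ∀ a, u a ≤ p.eval (size a)

namespace PolyBounded

variable {α β : Type} [Code α] [Code β] {u v : α → ℕ}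

theorem mono (hv : PolyBounded v) (h : ∀ a, u a ≤ v a) : PolyBounded u :=
  let ⟨p, hp⟩ := hv
  ⟨p, fun a => (h a).trans (hp a)⟩

theorem const (n : ℕ) : PolyBounded fun _ : α => n :=
  ⟨Polynomial.C n, fun a => by simp⟩

theorem size_self : PolyBounded fun a : α => size a :=
  ⟨Polynomial.X, fun a => by simp⟩

theorem add (hu : PolyBounded u) (hv : PolyBounded v) : PolyBounded fun a => u a + v a :=
  let ⟨p, hp⟩ := hu
  let ⟨q, hq⟩ := hv
  ⟨p + q, fun a => by rw [Polynomial.eval_add]; exact add_le_add (hp a) (hq a)⟩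

theorem mul (hu : PolyBounded u) (hv : PolyBounded v) : PolyBounded fun a => u a * v a :=
  let ⟨p, hp⟩ := hu
  let ⟨q, hq⟩ := hv
  ⟨p * q, fun a => by rw [Polynomial.eval_mul]; exact Nat.mul_le_mul (hp a) (hq a)⟩

theorem eval (p : Polynomial ℕ) (hu : PolyBounded u) : PolyBounded fun a => p.eval (u a) :=
  let ⟨q, hq⟩ := hu
  ⟨p.comp q, fun a => by rw [Polynomial.eval_comp]; exact eval_mono p (hq a)⟩

end PolyBounded

namespace PolyFun

variable {α β γ δ : Type} [Code α] [Code β] [Code γ] [Code δ]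

theorem size_bounded {f : α → β} (hf : PolyFun f) : PolyBounded fun a => size (f a) :=
  let ⟨_, p, h⟩ := hf
  ⟨p, fun a => (h a).1⟩

theorem exists_size_le {f : α → β} (hf : PolyFun f) :
    ∃ p : Polynomial ℕ, ∀ a, size (f a) ≤ p.eval (size a) := hf.size_bounded

/-- A program with separate bounds on the size of the result and on the number of steps. -/
theorem of_bounded {f : α → β} (c : Cmd) {u v : α → ℕ} (hu : PolyBounded u) (hv : PolyBounded v)
    (hs : ∀ a, size (f a) ≤ u a)
    (hc : ∀ a r, Exec c (single (word a ++ r)) (single (word (f a) ++ r)) (v a)) :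
    PolyFun f := by
  obtain ⟨p, hp⟩ := hu
  obtain ⟨q, hq⟩ := hv
  refine ⟨c, p + q, fun a => ?_⟩
  rw [Polynomial.eval_add]
  exact ⟨(hs a).trans ((hp a).trans (Nat.le_add_right _ _)),
    fun r => (hc a r).mono ((hq a).trans (Nat.le_add_left _ _))⟩

theorem of_tree_eq {f : α → β} (h : ∀ a, Code.tree (f a) = Code.tree a) : PolyFun f := by
  have hw : ∀ a, word (f a) = word a := fun a => by rw [word, h, word]
  refine of_bounded .skip .size_self (.const 1) (fun a => ?_) fun a r => ?_
  · rw [size, hw, size]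
  · rw [hw]; exact .skip le_rfl

@[fun_prop]
theorem id : PolyFun fun a : α => a := of_tree_eq fun _ => rfl

-- The second program runs in time polynomial in the size of the intermediate value; the size bound
-- that is part of `PolyFun` turns this into a polynomial in the size of the argument.
@[fun_prop]
theorem comp {g : β → γ} {f : α → β} (hg : PolyFun g) (hf : PolyFun f) :
    PolyFun fun a => g (f a) := by
  obtain ⟨c, p, h⟩ := hf
  obtain ⟨d, q, h'⟩ := hg
  have hb := PolyBounded.size_self (α := α).eval p
  refine of_bounded (.seq c d) (hb.eval q) (hb.add (hb.eval q)) (fun a => ?_) fun a r => ?_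
  · exact (h' _).1.trans (eval_mono q (h a).1)
  · exact .seq ((h a).2 r) ((h' _).2 r) (Nat.add_le_add_left (eval_mono q (h a).1) _)

@[fun_prop]
theorem const (b : β) : PolyFun fun _ : α => b := by
  refine of_bounded (.seq drop (pushWord (word b))) (.const (size b))
    ((((PolyBounded.const 7).mul .size_self).add (.const 3)).add (.const (size b + 1)))
    (fun a => le_rfl) fun a r => ?_
  exact (exec_drop _ r).then (exec_pushWord (word b) r)

-- The second component is computed first, on a copy. After an exchange the argument is on top again
-- and is replaced by the first component; the final `true` is the tag of a node. This works because
-- programs leave the stack below their argument untouched.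
@[fun_prop]
theorem prodMk {f : α → β} {g : α → γ} (hf : PolyFun f) (hg : PolyFun g) :
    PolyFun fun a => (f a, g a) := by
  obtain ⟨c, p, h⟩ := hf
  obtain ⟨d, q, h'⟩ := hg
  have hs := PolyBounded.size_self (α := α)
  refine of_bounded (.seq dup (.seq d (.seq exch (.seq c (.push 0 true)))))
    (((PolyBounded.const 1).add (hs.eval p)).add (hs.eval q))
    ((((PolyBounded.const 12).mul hs).add (.const 5)).add ((hs.eval q).add
      (((((PolyBounded.const 11).mul (hs.eval q)).add ((PolyBounded.const 7).mul hs)).add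
        (.const 8)).add ((hs.eval p).add (.const 1)))))
    (fun a => ?_) fun a r => ?_
  · rw [size_pair]
    exact add_le_add (add_le_add le_rfl (h a).1) (h' a).1
  · refine (exec_dup _ r).then (((h' a).2 (word a ++ r)).then (Exec.then
      ((exec_exch _ _ r).mono ?_) (((h a).2 (word (g a) ++ r)).then ?_)))
    · have := (h' a).1
      simp only [size, word] at this ⊢
      omega
    · rw [word_pair, List.cons_append, List.append_assoc]
      exact exec_push_single true _

theorem fst' : PolyFun fun a : α × β => a.1 := by
  refine of_bounded (.seq pop (.seq exch drop)) .size_self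
    ((PolyBounded.const 2).add ((((PolyBounded.const 18).mul .size_self).add (.const 8)).add
      (((PolyBounded.const 7).mul .size_self).add (.const 3)))) (fun a => ?_) fun a r => ?_
  · rw [size_pair a.1 a.2]; omega
  · have h := size_pair a.1 a.2
    simp only [Prod.mk.eta] at h
    rw [show word a = true :: (word a.1 ++ word a.2) from rfl, List.cons_append,
      List.append_assoc]
    refine (exec_pop _ _).then (((exec_exch _ _ r).mono ?_).then ((exec_drop _ _).mono ?_))
    · simp only [size, word] at h ⊢; omega
    · simp only [size, word] at h ⊢; omega

theorem snd' : PolyFun fun a : α × β => a.2 := by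
  refine of_bounded (.seq pop drop) .size_self
    ((PolyBounded.const 2).add (((PolyBounded.const 7).mul .size_self).add (.const 3)))
    (fun a => ?_) fun a r => ?_
  · rw [size_pair a.1 a.2]; omega
  · have h := size_pair a.1 a.2
    simp only [Prod.mk.eta] at h
    rw [show word a = true :: (word a.1 ++ word a.2) from rfl, List.cons_append,
      List.append_assoc]
    refine (exec_pop _ _).then ((exec_drop _ _).mono ?_)
    simp only [size, word] at h ⊢; omega

@[fun_prop]
theorem fst {f : α → β × γ} (hf : PolyFun f) : PolyFun fun a => (f a).1 := fst'.comp hf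

@[fun_prop]
theorem snd {f : α → β × γ} (hf : PolyFun f) : PolyFun fun a => (f a).2 := snd'.comp hf

/-- Remove the truth value on top of the stack `0` and continue accordingly. -/
def ifBool (f t : Cmd) : Cmd := .case 0 .skip f (.seq pop (.seq pop t))

theorem exec_ifBool {f t : Cmd} {b : Bool} {r : List Bool} {s : Store} {n : ℕ}
    (h : Exec (cond b t f) (single r) s n) :
    Exec (ifBool f t) (single (word b ++ r)) s (n + 5) := by
  cases b
  · refine .case_false (l := r) rfl (m := n) ?_ (by omega)
    simpa [single_eq_quad] using h
  · refine .case_true (l := false :: false :: r) rfl (m := 2 + (2 + n)) ?_ (by omega)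
    have := (exec_pop false (false :: r)).then ((exec_pop false r).then h)
    simpa [single_eq_quad] using this

@[fun_prop]
theorem cond {c : α → Bool} {f g : α → β} (hc : PolyFun c) (hf : PolyFun f) (hg : PolyFun g) :
    PolyFun fun a => bif c a then f a else g a := by
  -- Pairing with the identity keeps the argument available below the truth value.
  obtain ⟨k, p, h⟩ := hc.prodMk id
  obtain ⟨d, q, h'⟩ := hf
  obtain ⟨e, q', h''⟩ := hg
  have hs := PolyBounded.size_self (α := α)
  refine of_bounded (.seq k (.seq pop (ifBool e d))) ((hs.eval q).add (hs.eval q'))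
    ((hs.eval p).add ((PolyBounded.const 2).add (((hs.eval q).add (hs.eval q')).add (.const 5))))
    (fun a => ?_) fun a r => ?_
  · have h₁ := (h' a).1
    have h₂ := (h'' a).1
    cases c a <;> simp <;> omega
  · refine ((h a).2 r).then ?_
    rw [word_pair, List.cons_append, List.append_assoc]
    refine (exec_pop _ _).then (exec_ifBool ?_)
    cases c a
    · exact ((h'' a).2 r).mono (by omega)
    · exact ((h' a).2 r).mono (by omega)

/-- Functions that are computed by a loop whose states stay polynomially bounded. -/
theorem while_loop {init : α → β} {test : β → Bool} {step : β → β} (hi : PolyFun init)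
    (ht : PolyFun test) (hs : PolyFun step) (n : α → ℕ)
    (h_true : ∀ a, ∀ i < n a, test (step^[i] (init a)) = true)
    (h_false : ∀ a, test (step^[n a] (init a)) = false) (hn : PolyBounded n)
    {u : α → ℕ} (hu : PolyBounded u) (hb : ∀ a, ∀ i ≤ n a, size (step^[i] (init a)) ≤ u a) :
    PolyFun fun a => step^[n a] (init a) := by
  obtain ⟨c₀, p, h₀⟩ := hi
  obtain ⟨c₁, p₁, h₁⟩ := ht.prodMk id
  obtain ⟨c₂, p₂, h₂⟩ := hs
  -- A single `true` on stack `3` keeps the loop going. The loop consumes it, so the programs for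
  -- the test and the step find stack `3` empty; it is put back only if the test succeeds. `T`
  -- bounds the cost of a round, uniformly since no state exceeds `u`.
  set body := Cmd.seq c₁ (.seq pop (ifBool .skip (.seq c₂ (.push 3 true)))) with hbody
  set T : α → ℕ := fun a => p₁.eval (u a) + (2 + (p₂.eval (u a) + 1 + 5)) + 1 with hT
  have hT' : PolyBounded T :=
    ((hu.eval p₁).add ((PolyBounded.const 2).add
      (((hu.eval p₂).add (.const 1)).add (.const 5)))).add (.const 1)
  have hsz := PolyBounded.size_self (α := α)
  refine of_bounded (.seq c₀ (.seq (.push 3 true) (.loop 3 .skip body))) hu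
    ((hsz.eval p).add ((PolyBounded.const 1).add (((hn.add (.const 1)).mul hT').add (.const 1))))
    (fun a => hb a _ le_rfl) fun a r => ?_
  -- Induction on the number `k` of steps still to be made; one more round is needed for the test
  -- that fails.
  have key : ∀ k i, i + k = n a →
      Exec (.loop 3 .skip body) (quad (word (step^[i] (init a)) ++ r) [] [] [true])
        (single (word (step^[n a] (init a)) ++ r)) ((k + 1) * T a + 1) := by
    intro k
    induction k with
    | zero =>
      intro i hik
      obtain rfl : i = n a := by omega
      have e₁ := (h₁ (step^[n a] (init a))).2 r
      rw [word_pair, List.cons_append, List.append_assoc, h_false] at e₁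
      refine .loop_true (l := []) (by simp) (m := T a - 1) (s' := single _) ?_
        (.loop_nil rfl le_rfl) (by simp [hT])
      rw [update_quad_three, ← single_eq_quad]
      refine Exec.seq (e₁.mono (eval_mono p₁ (hb a _ le_rfl)))
        ((exec_pop _ _).then (exec_ifBool (n := 1) (.skip le_rfl))) (by simp [hT]; omega)
    | succ k ih =>
      intro i hik
      have e₁ := (h₁ (step^[i] (init a))).2 r
      rw [word_pair, List.cons_append, List.append_assoc, h_true a i (by omega)] at e₁
      have e₂ := (h₂ (step^[i] (init a))).2 r
      have e₃ := ih (i + 1) (by omega)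
      rw [Function.iterate_succ_apply'] at e₃
      have hbi := hb a i (by omega)
      refine .loop_true (l := []) (by simp) (m := T a - 1) ?_ e₃
        (by rw [Nat.add_mul (k + 1)]; simp only [hT]; omega)
      rw [update_quad_three, ← single_eq_quad]
      have e₄ := exec_push 3 true (single (word (step (step^[i] (init a))) ++ r))
      rw [single_eq_quad, update_quad_three, quad_three, ← single_eq_quad] at e₄
      refine Exec.seq (e₁.mono (eval_mono p₁ hbi))
        ((exec_pop _ _).then (exec_ifBool (n := p₂.eval (u a) + 1) ?_)) (by simp [hT])
      exact (e₂.mono (eval_mono p₂ hbi)).then e₄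
  have e := exec_push 3 true (single (word (init a) ++ r))
  rw [single_eq_quad, update_quad_three, quad_three] at e
  exact ((h₀ a).2 r).then (e.then (key (n a) 0 (by omega)))

end PolyFun

end StackProgram

/-! ### Lists, truth values and unary arithmetic in polynomial time -/

namespace StackProgram

namespace PolyFun

variable {α β γ δ : Type} [Code α] [Code β] [Code γ] [Code δ]

theorem congr {f g : α → β} (hg : PolyFun g) (h : ∀ a, f a = g a) : PolyFun f :=
  funext h ▸ hg

theorem exec_case_single {e f t : Cmd} {b : Bool} {r : List Bool} {s : Store} {n : ℕ}
    (h : Exec (bif b then t else f) (single r) s n) :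
    Exec (.case 0 e f t) (single (b :: r)) s (n + 1) := by
  cases b
  · exact .case_false (l := r) rfl (by simpa [single_eq_quad] using h) le_rfl
  · exact .case_true (l := r) rfl (by simpa [single_eq_quad] using h) le_rfl

theorem isEmpty' : PolyFun fun l : List α => l.isEmpty := by
  refine of_bounded (.case 0 .skip (pushWord [true, false, false]) (.seq drop (.seq drop
    (.push 0 false)))) (.const 3)
    ((((PolyBounded.const 7).mul .size_self).add (.const 20)))
    (fun a => size_bool_le _) fun l r => ?_
  cases l with
  | nil =>
    exact (exec_case_single (b := false) (exec_pushWord [true, false, false] r)).mono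
      (by simp)
  | cons a l =>
    rw [word_cons, List.cons_append, List.append_assoc]
    refine (exec_case_single (b := true) ((exec_drop (Code.tree a) (word l ++ r)).then
      ((exec_drop (Code.tree l) r).then (exec_push_single false r)))).mono ?_
    rw [size_cons, size, size, word, word]
    omega

theorem tail' : PolyFun fun l : List α => l.tail := by
  refine of_bounded (.case 0 .skip (.push 0 false) drop) .size_self
    ((((PolyBounded.const 7).mul .size_self).add (.const 20)))
    (fun l => size_le_of_sublist l.tail_sublist) fun l r => ?_
  cases l with
  | nil => exact (exec_case_single (b := false) (exec_push_single false r)).mono (by omega)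
  | cons a l =>
    rw [word_cons, List.cons_append, List.append_assoc]
    refine (exec_case_single (b := true) (exec_drop (Code.tree a) (word l ++ r))).mono ?_
    rw [size_cons, size, size, word, word]
    omega

theorem headD' (d : α) : PolyFun fun l : List α => l.headD d := by
  refine of_bounded (.case 0 .skip (pushWord (word d)) (.seq exch drop))
    (PolyBounded.size_self.add (.const (size d)))
    ((((PolyBounded.const 18).mul .size_self).add (.const (20 + size d))))
    (fun l => ?_) fun l r => ?_
  · cases l
    · simp
    · simp
      omega
  cases l with
  | nil =>
    refine (exec_case_single (b := false) (exec_pushWord (word d) r)).mono ?_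
    rw [size_nil, size]
    omega
  | cons a l =>
    rw [word_cons, List.cons_append, List.append_assoc]
    refine (exec_case_single (b := true) ((exec_exch (Code.tree a) (Code.tree l) r).then
      (exec_drop (Code.tree l) (word a ++ r)))).mono ?_
    rw [size_cons, size, size, size, word, word]
    omega

@[fun_prop]
theorem list_isEmpty {f : α → List β} (hf : PolyFun f) : PolyFun fun a => (f a).isEmpty :=
  isEmpty'.comp hf

@[fun_prop]
theorem list_tail {f : α → List β} (hf : PolyFun f) : PolyFun fun a => (f a).tail := tail'.comp hf

@[fun_prop]
theorem list_headD {f : α → List β} (hf : PolyFun f) (d : β) : PolyFun fun a => (f a).headD d :=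
  (headD' d).comp hf

@[fun_prop]
theorem list_cons {f : α → β} {g : α → List β} (hf : PolyFun f) (hg : PolyFun g) :
    PolyFun fun a => f a :: g a :=
  comp (g := fun p : β × List β => p.1 :: p.2) (of_tree_eq fun _ => rfl) (hf.prodMk hg)

@[fun_prop]
theorem list_replicate_unit {f : α → ℕ} (hf : PolyFun f) :
    PolyFun fun a => List.replicate (f a) () := by
  refine comp (g := fun n => List.replicate n ()) (of_tree_eq fun n => ?_) hf
  induction n with
  | zero => rfl
  | succ n ih => exact congrArg (BinTree.node .leaf) ih

theorem unit_length : PolyFun fun l : List Unit => l.length := by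
  refine of_tree_eq fun l => ?_
  induction l with
  | nil => rfl
  | cons _ l ih => exact congrArg (BinTree.node .leaf) ih

@[fun_prop]
theorem bool_not {f : α → Bool} (hf : PolyFun f) : PolyFun fun a => !(f a) := by
  have : PolyFun fun a => bif f a then false else true := by fun_prop
  exact this.congr fun a => by cases f a <;> rfl

@[fun_prop]
theorem bool_and {f g : α → Bool} (hf : PolyFun f) (hg : PolyFun g) :
    PolyFun fun a => f a && g a := by
  have : PolyFun fun a => bif f a then g a else false := by fun_prop
  exact this.congr fun a => by cases f a <;> rfl

/-- The state consists of the unread part of the list and the accumulator. The default head is never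
used, since at most as many steps are made as there are members. -/
theorem foldl_iterate {β γ : Type} (h : γ → β → γ) [Inhabited β] (l : List β) (x : γ) (i : ℕ)
    (hi : i ≤ l.length) :
    (fun s : List β × γ => (s.1.tail, h s.2 (s.1.headD default)))^[i] (l, x) =
      (l.drop i, (l.take i).foldl h x) := by
  induction i generalizing l x with
  | zero => simp
  | succ i ih =>
    cases l with
    | nil => simp at hi
    | cons b l =>
      rw [Function.iterate_succ_apply]
      exact ih l _ (by simpa using hi)

/-- A polynomial step alone is not enough: repeated doubling grows exponentially. Hence the bound on
the accumulator after every prefix. -/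
theorem list_foldl [Inhabited β] {f : α → List β} {g : α → γ} {h : α → γ → β → γ}
    (hf : PolyFun f) (hg : PolyFun g) (hh : PolyFun fun t : α × γ × β => h t.1 t.2.1 t.2.2)
    {u : α → ℕ} (hu : PolyBounded u)
    (hb : ∀ a l, l <+: f a → size (l.foldl (h a) (g a)) ≤ u a) :
    PolyFun fun a => (f a).foldl (h a) (g a) := by
  let step : α × List β × γ → α × List β × γ := fun s =>
    (s.1, s.2.1.tail, h s.1 s.2.2 (s.2.1.headD default))
  have hstep : PolyFun step := by
    have h₂ : PolyFun fun s : α × List β × γ => h s.1 s.2.2 (s.2.1.headD default) :=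
      hh.comp (f := fun s : α × List β × γ => (s.1, s.2.2, s.2.1.headD default)) (by fun_prop)
    fun_prop
  have hit : ∀ a i, i ≤ (f a).length →
      step^[i] (a, f a, g a) = (a, (f a).drop i, ((f a).take i).foldl (h a) (g a)) := by
    intro a i hi
    rw [← foldl_iterate (h a) (f a) (g a) i hi]
    clear hi
    induction i with
    | zero => rfl
    | succ i ih => rw [Function.iterate_succ_apply', Function.iterate_succ_apply', ih]
  have key : PolyFun fun a => step^[(f a).length] (a, f a, g a) := by
    refine while_loop (test := fun s => !s.2.1.isEmpty) (by fun_prop) (by fun_prop) hstep _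
      (fun a i hi => ?_) (fun a => ?_) (hf.size_bounded.mono fun a => (length_lt_size _).le)
      (((PolyBounded.const 1).add .size_self).add
        (((PolyBounded.const 1).add hf.size_bounded).add hu)) (fun a i hi => ?_)
    · rw [hit a i hi.le]
      simpa using hi
    · rw [hit a _ le_rfl]
      simp
    · rw [hit a i hi, size_pair, size_pair]
      have h₁ := size_le_of_sublist (List.drop_sublist i (f a))
      have h₂ := hb a _ (List.take_prefix i (f a))
      omega
  have e : (fun a => (f a).foldl (h a) (g a)) =
      fun a => (step^[(f a).length] (a, f a, g a)).2.2 := by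
    funext a
    rw [hit a _ le_rfl]
    simp
  rw [e]
  exact key.snd.snd

/-- If every member adds at most `u a` to the size, the total growth is at most the length of the
list times `u a`, which is polynomial. -/
theorem list_foldl_of_increment [Inhabited β] {f : α → List β} {g : α → γ} {h : α → γ → β → γ}
    (hf : PolyFun f) (hg : PolyFun g) (hh : PolyFun fun t : α × γ × β => h t.1 t.2.1 t.2.2)
    {u : α → ℕ} (hu : PolyBounded u)
    (hb : ∀ a x b, b ∈ f a → size (h a x b) ≤ size x + u a) :
    PolyFun fun a => (f a).foldl (h a) (g a) := by
  refine list_foldl hf hg hh (hg.size_bounded.add (hf.size_bounded.mul hu)) fun a l hl => ?_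
  have key : ∀ (l : List β) (x : γ), (∀ b ∈ l, b ∈ f a) →
      size (l.foldl (h a) x) ≤ size x + l.length * u a := by
    intro l
    induction l with
    | nil => simp
    | cons b l ih =>
      intro x hx
      have h₁ := ih (h a x b) fun c hc => hx c (by simp [hc])
      have h₂ := hb a x b (hx b (by simp))
      simp only [List.foldl_cons, List.length_cons, Nat.add_mul, one_mul]
      omega
  refine (key l (g a) fun b hb => hl.subset hb).trans (Nat.add_le_add_left ?_ _)
  exact Nat.mul_le_mul_right _ (hl.length_le.trans (length_lt_size _).le)

/-- A bound on the values at the members of a list. -/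
theorem size_bounded_mem {f : α → List β} {g : α → β → γ} (hf : PolyFun f)
    (hg : PolyFun fun t : α × β => g t.1 t.2) :
    ∃ u : α → ℕ, PolyBounded u ∧ ∀ a, ∀ b ∈ f a, size (g a b) ≤ u a := by
  obtain ⟨p, hp⟩ := hg.exists_size_le
  refine ⟨_, (((PolyBounded.const 1).add .size_self).add hf.size_bounded).eval p,
    fun a b hb => (hp (a, b)).trans (eval_mono p ?_)⟩
  have := size_le_of_mem hb
  simp
  omega

@[fun_prop]
theorem list_reverse [Inhabited β] {f : α → List β} (hf : PolyFun f) :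
    PolyFun fun a => (f a).reverse := by
  have : PolyFun fun a => (f a).foldl (fun l b => b :: l) [] := by
    refine list_foldl_of_increment hf (by fun_prop) (by fun_prop)
      ((PolyBounded.const 1).add hf.size_bounded) fun a x b hb => ?_
    have := size_le_of_mem hb
    simp
    omega
  simpa using this

@[fun_prop]
theorem list_append [Inhabited β] {f g : α → List β} (hf : PolyFun f) (hg : PolyFun g) :
    PolyFun fun a => f a ++ g a := by
  have : PolyFun fun a => (f a).reverse.foldl (fun l b => b :: l) (g a) := by
    refine list_foldl_of_increment (by fun_prop) hg (by fun_prop)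
      ((PolyBounded.const 1).add hf.size_bounded) fun a x b hb => ?_
    have := size_le_of_mem (List.mem_reverse.1 hb)
    simp
    omega
  simpa using this

@[fun_prop]
theorem list_flatMap [Inhabited β] [Inhabited γ] {f : α → List β} {g : α → β → List γ}
    (hf : PolyFun f) (hg : PolyFun fun t : α × β => g t.1 t.2) :
    PolyFun fun a => (f a).flatMap (g a) := by
  obtain ⟨u, hu, hb⟩ := size_bounded_mem hf hg
  have hg' : PolyFun fun t : α × List γ × β => g t.1 t.2.2 :=
    hg.comp (f := fun t : α × List γ × β => (t.1, t.2.2)) (by fun_prop)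
  have : PolyFun fun a => (f a).foldl (fun l b => l ++ g a b) [] := by
    refine list_foldl_of_increment hf (by fun_prop) (by fun_prop) hu fun a x b h => ?_
    have h₁ := hb a b h
    have h₂ := size_append x (g a b)
    omega
  have e : ∀ a, ∀ (l : List β) (x : List γ),
      l.foldl (fun l b => l ++ g a b) x = x ++ l.flatMap (g a) := by
    intro a l
    induction l with
    | nil => simp
    | cons b l ih => intro x; simp [ih]
  simpa [e] using this

@[fun_prop]
theorem list_map [Inhabited β] [Inhabited γ] {f : α → List β} {g : α → β → γ}
    (hf : PolyFun f) (hg : PolyFun fun t : α × β => g t.1 t.2) :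
    PolyFun fun a => (f a).map (g a) := by
  have : PolyFun fun a => (f a).flatMap fun b => [g a b] :=
    list_flatMap hf (list_cons hg (const []))
  simpa only [← List.map_eq_flatMap] using this

@[fun_prop]
theorem list_filter [Inhabited β] {f : α → List β} {g : α → β → Bool}
    (hf : PolyFun f) (hg : PolyFun fun t : α × β => g t.1 t.2) :
    PolyFun fun a => (f a).filter (g a) := by
  have : PolyFun fun a => (f a).flatMap fun b => bif g a b then [b] else [] :=
    list_flatMap hf (cond hg (by fun_prop) (by fun_prop))
  have e : ∀ (g : β → Bool) (l : List β),
      (l.flatMap fun b => bif g b then [b] else []) = l.filter g := by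
    intro g l
    induction l with
    | nil => rfl
    | cons b l ih => cases h : g b <;> simp [ih, h]
  simpa only [e] using this

@[fun_prop]
theorem list_any [Inhabited β] {f : α → List β} {g : α → β → Bool}
    (hf : PolyFun f) (hg : PolyFun fun t : α × β => g t.1 t.2) :
    PolyFun fun a => (f a).any (g a) := by
  have : PolyFun fun a => !((f a).filter (g a)).isEmpty := by fun_prop
  have e : ∀ (g : β → Bool) (l : List β), (!(l.filter g).isEmpty) = l.any g := by
    intro g l
    induction l with
    | nil => rfl
    | cons b l ih => cases h : g b <;> simp [← ih, h]
  simpa only [e] using this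

@[fun_prop]
theorem list_all [Inhabited β] {f : α → List β} {g : α → β → Bool}
    (hf : PolyFun f) (hg : PolyFun fun t : α × β => g t.1 t.2) :
    PolyFun fun a => (f a).all (g a) := by
  have : PolyFun fun a => !(f a).any (fun b => !(g a b)) := by fun_prop
  have e : ∀ (g : β → Bool) (l : List β), (!l.any fun b => !(g b)) = l.all g := by
    intro g l
    induction l with
    | nil => rfl
    | cons b l ih => simp [← ih]
  simpa only [e] using this

@[fun_prop]
theorem list_length [Inhabited β] {f : α → List β} (hf : PolyFun f) :
    PolyFun fun a => (f a).length := by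
  have : PolyFun fun a => ((f a).map fun _ => ()).length := unit_length.comp (by fun_prop)
  simpa using this

/-- Iteration of a function with polynomially bounded iterates. -/
theorem iterate {n : α → ℕ} {g : α → β} {h : α → β → β} (hn : PolyFun n) (hg : PolyFun g)
    (hh : PolyFun fun t : α × β => h t.1 t.2) {u : α → ℕ} (hu : PolyBounded u)
    (hb : ∀ a, ∀ i ≤ n a, size ((h a)^[i] (g a)) ≤ u a) :
    PolyFun fun a => (h a)^[n a] (g a) := by
  have e : ∀ a (l : List Unit) x, l.foldl (fun x _ => h a x) x = (h a)^[l.length] x := by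
    intro a l
    induction l with
    | nil => simp
    | cons b l ih => intro x; simp [ih]
  -- A unary number is a list of units, so iteration is a fold over it.
  have : PolyFun fun a => (List.replicate (n a) ()).foldl (fun x _ => h a x) (g a) := by
    refine list_foldl (by fun_prop) hg
      (hh.comp (f := fun t : α × β × Unit => (t.1, t.2.1)) (by fun_prop)) hu fun a l hl => ?_
    rw [e]
    exact hb a _ (by simpa using hl.length_le)
  simpa only [e, List.length_replicate] using this

@[fun_prop]
theorem nat_succ {f : α → ℕ} (hf : PolyFun f) : PolyFun fun a => f a + 1 :=
  comp (g := fun p : Unit × ℕ => p.2 + 1) (of_tree_eq fun _ => rfl) ((const ()).prodMk hf)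

@[fun_prop]
theorem nat_pred {f : α → ℕ} (hf : PolyFun f) : PolyFun fun a => (f a).pred := by
  have : PolyFun fun a => (List.replicate (f a) ()).tail.length := by fun_prop
  simpa using this

@[fun_prop]
theorem nat_add {f g : α → ℕ} (hf : PolyFun f) (hg : PolyFun g) :
    PolyFun fun a => f a + g a := by
  have : PolyFun fun a => Nat.succ^[g a] (f a) := by
    refine iterate hg hf (nat_succ (by fun_prop)) (hf.size_bounded.add hg.size_bounded) fun a i hi => ?_
    simp [Nat.succ_iterate]
    omega
  simpa [Nat.succ_iterate] using this

theorem add_iterate_eq (m n x : ℕ) : (fun x => x + m)^[n] x = x + n * m := by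
  induction n with
  | zero => simp
  | succ n ih => rw [Function.iterate_succ_apply', ih, Nat.succ_mul]; omega

@[fun_prop]
theorem nat_mul {f g : α → ℕ} (hf : PolyFun f) (hg : PolyFun g) :
    PolyFun fun a => f a * g a := by
  have : PolyFun fun a => (fun x => x + g a)^[f a] 0 := by
    refine iterate hf (by fun_prop) (by fun_prop)
      (((PolyBounded.const 2).mul (hf.size_bounded.mul hg.size_bounded)).add (.const 1))
      fun a i hi => ?_
    have : i * g a ≤ size (f a) * size (g a) := Nat.mul_le_mul (by simp; omega) (by simp; omega)
    rw [add_iterate_eq, size_nat]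
    omega
  simpa [add_iterate_eq] using this

theorem pred_iterate_eq (n m : ℕ) : Nat.pred^[n] m = m - n := by
  induction n with
  | zero => simp
  | succ n ih => rw [Function.iterate_succ_apply', ih]; rfl

@[fun_prop]
theorem nat_sub {f g : α → ℕ} (hf : PolyFun f) (hg : PolyFun g) :
    PolyFun fun a => f a - g a := by
  have : PolyFun fun a => Nat.pred^[g a] (f a) := by
    refine iterate hg hf (by fun_prop) hf.size_bounded fun a i hi => ?_
    rw [pred_iterate_eq, size_nat, size_nat]
    omega
  simpa [pred_iterate_eq] using this

@[fun_prop]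
theorem nat_ble {f g : α → ℕ} (hf : PolyFun f) (hg : PolyFun g) :
    PolyFun fun a => (f a).ble (g a) := by
  have : PolyFun fun a => (List.replicate (f a - g a) ()).isEmpty := by fun_prop
  refine this.congr fun a => ?_
  rw [Bool.eq_iff_iff]
  simp [Nat.sub_eq_zero_iff_le]

@[fun_prop]
theorem nat_beq {f g : α → ℕ} (hf : PolyFun f) (hg : PolyFun g) :
    PolyFun fun a => f a == g a := by
  have : PolyFun fun a => (f a).ble (g a) && (g a).ble (f a) := by fun_prop
  refine this.congr fun a => ?_
  rw [Bool.eq_iff_iff]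
  simp
  omega

@[fun_prop]
theorem nat_min {f g : α → ℕ} (hf : PolyFun f) (hg : PolyFun g) :
    PolyFun fun a => min (f a) (g a) := by
  have : PolyFun fun a => f a - (f a - g a) := by fun_prop
  refine this.congr fun a => ?_
  omega

theorem range_iterate (n : ℕ) : (fun l : List ℕ => l ++ [l.length])^[n] [] = List.range n := by
  induction n with
  | zero => rfl
  | succ n ih => rw [Function.iterate_succ_apply', ih, List.range_succ, List.length_range]

@[fun_prop]
theorem list_range {f : α → ℕ} (hf : PolyFun f) : PolyFun fun a => List.range (f a) := by
  have : PolyFun fun a => (fun l : List ℕ => l ++ [l.length])^[f a] [] := by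
    refine iterate hf (by fun_prop) (by fun_prop) ((PolyBounded.const 1).add
      (hf.size_bounded.mul ((PolyBounded.const 1).add hf.size_bounded))) fun a i hi => ?_
    rw [range_iterate]
    refine (size_le_of_forall (b := size (f a)) fun x hx => ?_).trans
      (Nat.add_le_add_left (Nat.mul_le_mul_right _ ?_) _)
    · have := List.mem_range.1 hx
      simp
      omega
    · simp
      omega
  simpa only [range_iterate] using this

theorem tail_iterate_eq {β : Type} (n : ℕ) (l : List β) : List.tail^[n] l = l.drop n := by
  induction n with
  | zero => rfl
  | succ n ih => rw [Function.iterate_succ_apply', ih, List.tail_drop]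

@[fun_prop]
theorem list_drop {n : α → ℕ} {f : α → List β} (hn : PolyFun n) (hf : PolyFun f) :
    PolyFun fun a => (f a).drop (n a) := by
  have : PolyFun fun a => List.tail^[n a] (f a) := by
    refine iterate hn hf (by fun_prop) hf.size_bounded fun a i hi => ?_
    rw [tail_iterate_eq]
    exact size_le_of_sublist (List.drop_sublist _ _)
  simpa only [tail_iterate_eq] using this

@[fun_prop]
theorem list_getD {n : α → ℕ} {f : α → List β} (hf : PolyFun f) (hn : PolyFun n) (d : β) :
    PolyFun fun a => (f a).getD (n a) d := by
  have : PolyFun fun a => ((f a).drop (n a)).headD d := by fun_prop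
  simpa [List.head?_drop] using this

@[fun_prop]
theorem list_sum {f : α → List ℕ} (hf : PolyFun f) : PolyFun fun a => (f a).sum := by
  have : PolyFun fun a => (f a).foldl (fun x b => x + b) 0 := by
    refine list_foldl_of_increment hf (by fun_prop) (by fun_prop) hf.size_bounded
      fun a x b hb => ?_
    have := size_le_of_mem hb
    simp at this ⊢
    omega
  simpa only [List.sum_eq_foldl] using this

end PolyFun

end StackProgram

/-! ### From raw words to coded values and back -/

namespace StackProgram

/-- Rewrite the contents of the stack `0` as the code of a list of bits. -/
def readInput : Cmd := .seq (pour 0 1) (.seq (.push 0 false)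
  (.loop 1 (pushWord [true, false]) (pushWord [true, true, false, false])))

/-- The two pushed words are the tag of a list node followed by the code of the bit. The word has
been reversed onto stack `1`, so prepending bit by bit restores its order. -/
theorem exec_readInput_loop (l : List Bool) : ∀ m : List Bool,
    Exec (.loop 1 (pushWord [true, false]) (pushWord [true, true, false, false]))
      (quad (word m) l [] []) (single (word (l.reverse ++ m))) (6 * l.length + 1) := by
  induction l with
  | nil => intro m; exact .loop_nil rfl le_rfl
  | cons b l ih =>
    intro m
    have hp : ∀ w : List Bool, Exec (pushWord w) (quad (word m) l [] [])
        (quad (w ++ word m) l [] []) (w.length + 1) := by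
      intro w
      induction w with
      | nil => exact .skip le_rfl
      | cons b w ih =>
        have h := ih.then (exec_push 0 b (quad (w ++ word m) l [] []))
        rw [quad_zero, update_quad_zero] at h
        exact h
    have h := ih (b :: m)
    rw [List.reverse_cons, List.append_assoc]
    cases b
    · exact .loop_false (l := l) rfl (by rw [update_quad_one]; exact hp [true, false]) h
        (by simp; omega)
    · exact .loop_true (l := l) rfl (by rw [update_quad_one]; exact hp [true, true, false, false]) h
        (by simp; omega)

theorem exec_readInput (l : List Bool) :
    Exec readInput (single l) (single (word l)) (8 * l.length + 3) := by
  have h₁ := exec_pour (j := 0) (k := 1) (by decide) l (single l) rfl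
  have h₂ := exec_push 0 false (quad [] l.reverse [] [])
  have h₃ := exec_readInput_loop l.reverse []
  simp only [single_eq_quad, quad_zero, update_quad_zero, quad_one, update_quad_one,
    List.append_nil, List.reverse_reverse, List.length_reverse] at h₁ h₂ h₃
  exact (h₁.then (h₂.then h₃)).mono (by omega)

/-- Rewrite the code of a truth value as a single bit. -/
def writeOutput : Cmd := PolyFun.ifBool (.push 0 false) (.push 0 true)

theorem exec_writeOutput (b : Bool) : Exec writeOutput (single (word b)) (single [b]) 6 := by
  have h := PolyFun.exec_ifBool (f := .push 0 false) (t := .push 0 true) (b := b) (r := [])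
    (s := single [b]) (n := 1) (by cases b <;> exact exec_push_single _ [])
  rwa [List.append_nil] at h

/-- A decision problem is decidable in polynomial time by a multi-stack machine if its answers are
computed from the encoded instances by a polynomial time function on lists of bits. -/
theorem PolyFun.polyTime {α : Type} {ea : α → List Bool} {f : α → Bool} {g : List Bool → Bool}
    (hg : PolyFun g) (h : ∀ a, g (ea a) = f a) :
    Nonempty (Turing.TM2ComputableInPolyTime ea Computability.encodeBool f) := by
  obtain ⟨c, p, hc⟩ := hg
  refine polyTime_of_exec (.seq readInput (.seq c writeOutput))
    -- The summands are the costs of reading, computing and writing; a list of `n` bits has size at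
    -- most `1 + 4 * n`.
    (8 * Polynomial.X + 3 + (p.comp (1 + Polynomial.X * 4) + 6)) fun a => ?_
  have hs : size (ea a) ≤ 1 + (ea a).length * (1 + 3) :=
    size_le_of_forall fun b _ => size_bool_le b
  have h₂ := (hc (ea a)).2 []
  rw [List.append_nil, List.append_nil, h] at h₂
  refine ((exec_readInput (ea a)).then (((h₂.mono (eval_mono p hs)).then
    (exec_writeOutput (f a))))).mono ?_
  simp [Polynomial.eval_comp]

end StackProgram

/-! ### The decision procedure on the list of tables -/

namespace NormRecognition

/-- The list of numbers that a word encodes. -/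
def decodeNats (w : List Bool) : List ℕ :=
  (w.foldl (fun x b => bif b then (x.1, x.2 + 1) else (x.2 :: x.1, 0))
    (([], 0) : List ℕ × ℕ)).1.reverse

/-- The members of a list that have a successor in it. -/
def survivors {V : Type} (E : V → V → Bool) (D : List V) : List V :=
  D.filter fun x => D.any (E x)

namespace Table

/-! Functions that look up the data of an instance in the list `l` of its tables. -/

/-- A missing entry is read as `0`. All lookups are thus total on arbitrary lists, as `PolyFun`
requires, while correctness matters only on the tables of an instance. -/
def agents (l : List ℕ) : ℕ := l.getD 0 0

def acts (l : List ℕ) : List ℕ := (List.range (agents l)).map fun i => l.getD (i + 1) 0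

/-- The number of joint actions, cut off at the length of the list. -/
def joint (l : List ℕ) : ℕ := (acts l).foldl (fun x k => min (x * k) l.length) 1

def sysPart (l : List ℕ) : List ℕ := l.drop (agents l + 1)

def states (l : List ℕ) : ℕ := (sysPart l).getD 0 0

def props (l : List ℕ) : ℕ := (sysPart l).getD 2 0

/-- The offset covers three cardinalities, the available actions and the observations of the agents.
-/
def initialPart (l : List ℕ) : List ℕ :=
  (sysPart l).drop (3 + states l * (acts l).sum + agents l * states l)

def initial (l : List ℕ) (s : ℕ) : Bool := (initialPart l).getD s 0 == 1

def transPart (l : List ℕ) : List ℕ := (initialPart l).drop (states l)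

def trans (l : List ℕ) (s a s' : ℕ) : Bool :=
  (transPart l).getD (s * (joint l * states l) + (a * states l + s')) 0 == 1

def obsPart (l : List ℕ) : List ℕ :=
  (transPart l).drop (states l * (joint l * states l) + states l * props l)

def newObs (l : List ℕ) (s : ℕ) : ℕ := (obsPart l).getD s 0

def othersPart (l : List ℕ) : List ℕ := (obsPart l).drop (states l)

def others (l : List ℕ) : ℕ := (othersPart l).getD 0 0

/-- Skip one table of a normative system. -/
def skipNorm (l t : List ℕ) : List ℕ :=
  t.drop (2 + states l * (t.getD 0 0 * joint l) + t.getD 0 0 * states l)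

def normPart (l : List ℕ) (j : ℕ) : List ℕ := (skipNorm l)^[j] ((othersPart l).drop 1)

def norms (l : List ℕ) (j : ℕ) : ℕ := (normPart l j).getD 0 0

def start (l : List ℕ) (j : ℕ) : ℕ := (normPart l j).getD 1 0

def disallowed (l : List ℕ) (j s q a : ℕ) : Bool :=
  (normPart l j).getD (2 + (s * (norms l j * joint l) + (q * joint l + a))) 0 == 1

def update (l : List ℕ) (j q s : ℕ) : ℕ :=
  (normPart l j).getD (2 + states l * (norms l j * joint l) + (q * states l + s)) 0

/-- The initial states of the Kripke structure of a normative system. -/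
def isStart (l : List ℕ) (j : ℕ) (w : ℕ × ℕ) : Bool := initial l w.1 && w.2 == start l j

/-- The transitions of the Kripke structure of a normative system. -/
def edge (l : List ℕ) (j : ℕ) (w w' : ℕ × ℕ) : Bool :=
  (List.range (joint l)).any (fun a => trans l w.1 a w'.1 && !(disallowed l j w.1 w.2 a)) &&
    w'.2 == update l j w.2 w'.1

/-- The states of the Kripke structure of a normative system. -/
def worlds (l : List ℕ) (j : ℕ) : List (ℕ × ℕ) :=
  (List.range (states l)).flatMap fun s => (List.range (norms l j)).map fun q => (s, q)

/-- The pairs of a state of the active structure and a state of another one that have the same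
observation. -/
def pairs (l : List ℕ) (j : ℕ) : List ((ℕ × ℕ) × (ℕ × ℕ)) :=
  ((worlds l 0).flatMap fun w => (worlds l j).map fun w' => (w, w')).filter fun x =>
    newObs l x.1.1 == newObs l x.2.1

def pairEdge (l : List ℕ) (j : ℕ) (x y : (ℕ × ℕ) × (ℕ × ℕ)) : Bool :=
  edge l 0 x.1 y.1 && edge l j x.2 y.2

/-- The pairs from which there are arbitrarily long paths. -/
def core (l : List ℕ) (j : ℕ) : List ((ℕ × ℕ) × (ℕ × ℕ)) :=
  (survivors (pairEdge l j))^[(pairs l j).length] (pairs l j)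

/-- No pair of initial states has arbitrarily long paths. -/
def recognized (l : List ℕ) (j : ℕ) : Bool :=
  (core l j).all fun x => !(isStart l 0 x.1 && isStart l j x.2)

/-- The shift by one leaves out the active system, which has index `0`. -/
def decideNC1 (l : List ℕ) : Bool := (List.range (others l)).all fun j => recognized l (j + 1)

open StackProgram

variable {α : Type} [Code α] {l t : α → List ℕ} {j s a s' q : α → ℕ} {w w' : α → ℕ × ℕ}
  {x y : α → (ℕ × ℕ) × (ℕ × ℕ)}

theorem _root_.NormRecognition.polyFun_decodeNats : PolyFun decodeNats := by
  unfold decodeNats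
  refine (PolyFun.fst ?_).list_reverse
  -- Each letter adds `2` to the size: `true` enlarges the unary counter by one, `false` moves the
  -- counter into the list and adds a list node and a new zero.
  refine PolyFun.list_foldl_of_increment .id (.const _) (by fun_prop) (.const 2) fun _ x b _ => ?_
  obtain ⟨x, n⟩ := x
  cases b <;> simp <;> omega

@[fun_prop]
theorem polyFun_agents (hl : PolyFun l) : PolyFun fun i => agents (l i) := by
  unfold agents; fun_prop

@[fun_prop]
theorem polyFun_acts (hl : PolyFun l) : PolyFun fun i => acts (l i) := by
  unfold acts; fun_prop

@[fun_prop]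
theorem polyFun_joint (hl : PolyFun l) : PolyFun fun i => joint (l i) := by
  unfold joint
  -- On an arbitrary list the product may be exponentially large; the cut-off keeps all partial
  -- products below the length of the list.
  refine PolyFun.list_foldl_of_increment (by fun_prop) (by fun_prop) (by fun_prop)
    ((PolyBounded.const 2).mul hl.size_bounded) fun i x b _ => ?_
  have h₁ := length_lt_size (l i)
  have h₂ := min_le_right (x * b) (l i).length
  simp only [size_nat]
  omega

@[fun_prop]
theorem polyFun_sysPart (hl : PolyFun l) : PolyFun fun i => sysPart (l i) := by
  unfold sysPart; fun_prop

@[fun_prop]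
theorem polyFun_states (hl : PolyFun l) : PolyFun fun i => states (l i) := by
  unfold states; fun_prop

@[fun_prop]
theorem polyFun_props (hl : PolyFun l) : PolyFun fun i => props (l i) := by
  unfold props; fun_prop

@[fun_prop]
theorem polyFun_initialPart (hl : PolyFun l) : PolyFun fun i => initialPart (l i) := by
  unfold initialPart; fun_prop

@[fun_prop]
theorem polyFun_initial (hl : PolyFun l) (hs : PolyFun s) :
    PolyFun fun i => initial (l i) (s i) := by
  unfold initial; fun_prop

@[fun_prop]
theorem polyFun_transPart (hl : PolyFun l) : PolyFun fun i => transPart (l i) := by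
  unfold transPart; fun_prop

@[fun_prop]
theorem polyFun_trans (hl : PolyFun l) (hs : PolyFun s) (ha : PolyFun a) (hs' : PolyFun s') :
    PolyFun fun i => trans (l i) (s i) (a i) (s' i) := by
  unfold trans; fun_prop

@[fun_prop]
theorem polyFun_obsPart (hl : PolyFun l) : PolyFun fun i => obsPart (l i) := by
  unfold obsPart; fun_prop

@[fun_prop]
theorem polyFun_newObs (hl : PolyFun l) (hs : PolyFun s) :
    PolyFun fun i => newObs (l i) (s i) := by
  unfold newObs; fun_prop

@[fun_prop]
theorem polyFun_othersPart (hl : PolyFun l) : PolyFun fun i => othersPart (l i) := by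
  unfold othersPart; fun_prop

@[fun_prop]
theorem polyFun_others (hl : PolyFun l) : PolyFun fun i => others (l i) := by
  unfold others; fun_prop

@[fun_prop]
theorem polyFun_skipNorm (hl : PolyFun l) (ht : PolyFun t) :
    PolyFun fun i => skipNorm (l i) (t i) := by
  unfold skipNorm; fun_prop

/-- Skipping tables and deleting pairs only shrink a list, which provides the bound on the iterates
that `PolyFun.iterate` needs. -/
theorem iterate_sublist {V : Type} {f : List V → List V} (hf : ∀ l, (f l).Sublist l) (l : List V)
    (n : ℕ) : (f^[n] l).Sublist l := by
  induction n with
  | zero => exact .refl l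
  | succ n ih => rw [Function.iterate_succ_apply']; exact (hf _).trans ih

@[fun_prop]
theorem polyFun_normPart (hl : PolyFun l) (hj : PolyFun j) :
    PolyFun fun i => normPart (l i) (j i) := by
  unfold normPart
  have h : PolyFun fun i => (othersPart (l i)).drop 1 := by fun_prop
  refine PolyFun.iterate hj h (by fun_prop) h.size_bounded fun i n _ => ?_
  exact size_le_of_sublist (iterate_sublist (fun t => List.drop_sublist _ _) _ _)

@[fun_prop]
theorem polyFun_norms (hl : PolyFun l) (hj : PolyFun j) :
    PolyFun fun i => norms (l i) (j i) := by
  unfold norms; fun_prop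

@[fun_prop]
theorem polyFun_start (hl : PolyFun l) (hj : PolyFun j) :
    PolyFun fun i => start (l i) (j i) := by
  unfold start; fun_prop

@[fun_prop]
theorem polyFun_disallowed (hl : PolyFun l) (hj : PolyFun j) (hs : PolyFun s) (hq : PolyFun q)
    (ha : PolyFun a) : PolyFun fun i => disallowed (l i) (j i) (s i) (q i) (a i) := by
  unfold disallowed; fun_prop

@[fun_prop]
theorem polyFun_update (hl : PolyFun l) (hj : PolyFun j) (hq : PolyFun q) (hs : PolyFun s) :
    PolyFun fun i => update (l i) (j i) (q i) (s i) := by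
  unfold update; fun_prop

@[fun_prop]
theorem polyFun_isStart (hl : PolyFun l) (hj : PolyFun j) (hw : PolyFun w) :
    PolyFun fun i => isStart (l i) (j i) (w i) := by
  unfold isStart; fun_prop

@[fun_prop]
theorem polyFun_edge (hl : PolyFun l) (hj : PolyFun j) (hw : PolyFun w) (hw' : PolyFun w') :
    PolyFun fun i => edge (l i) (j i) (w i) (w' i) := by
  unfold edge; fun_prop

@[fun_prop]
theorem polyFun_worlds (hl : PolyFun l) (hj : PolyFun j) :
    PolyFun fun i => worlds (l i) (j i) := by
  unfold worlds; fun_prop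

@[fun_prop]
theorem polyFun_pairs (hl : PolyFun l) (hj : PolyFun j) :
    PolyFun fun i => pairs (l i) (j i) := by
  unfold pairs; fun_prop

@[fun_prop]
theorem polyFun_pairEdge (hl : PolyFun l) (hj : PolyFun j) (hx : PolyFun x) (hy : PolyFun y) :
    PolyFun fun i => pairEdge (l i) (j i) (x i) (y i) := by
  unfold pairEdge; fun_prop

@[fun_prop]
theorem polyFun_core (hl : PolyFun l) (hj : PolyFun j) :
    PolyFun fun i => core (l i) (j i) := by
  unfold core
  have h : PolyFun fun i => pairs (l i) (j i) := by fun_prop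
  refine PolyFun.iterate (by fun_prop) h ?_ h.size_bounded fun i n _ => ?_
  · unfold survivors; fun_prop
  · exact size_le_of_sublist (iterate_sublist (fun D => List.filter_sublist) _ _)

@[fun_prop]
theorem polyFun_recognized (hl : PolyFun l) (hj : PolyFun j) :
    PolyFun fun i => recognized (l i) (j i) := by
  unfold recognized; fun_prop

theorem polyFun_decideNC1 : PolyFun decideNC1 := by
  unfold decideNC1; fun_prop

end Table

end NormRecognition

/-! ### Correctness of the decoding and of the table lookups -/

namespace NormRecognition

theorem decodeNats_encodeNats (l : List ℕ) :
    decodeNats (NC1Instance.encodeNats l) = l := by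
  set f : List ℕ × ℕ → Bool → List ℕ × ℕ :=
    fun x b => bif b then (x.1, x.2 + 1) else (x.2 :: x.1, 0)
  have h₁ : ∀ n (x : List ℕ) (m : ℕ), (List.replicate n true).foldl f (x, m) = (x, m + n) := by
    intro n
    induction n with
    | zero => intro x m; rfl
    | succ n ih =>
      intro x m
      rw [List.replicate_succ, List.foldl_cons]
      refine (ih x (m + 1)).trans ?_
      rw [Nat.add_right_comm, Nat.add_assoc]
  have h₂ : ∀ (l : List ℕ) (x : List ℕ),
      (NC1Instance.encodeNats l).foldl f (x, 0) = (l.reverse ++ x, 0) := by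
    intro l
    induction l with
    | nil => intro x; rfl
    | cons n l ih =>
      intro x
      have h := ih (n :: x)
      simp only [NC1Instance.encodeNats, List.flatMap_cons, List.foldl_append, h₁, zero_add]
        at h ⊢
      rw [show List.foldl f (x, n) [false] = (n :: x, 0) from rfl, h]
      simp
  change ((NC1Instance.encodeNats l).foldl f ([], 0)).1.reverse = l
  rw [h₂]
  simp

section Lists

variable {n m : ℕ}

theorem length_flatMap_finRange (f : Fin n → List ℕ) (h : ∀ i, (f i).length = m) :
    ((List.finRange n).flatMap f).length = n * m := by
  simp [List.length_flatMap, h]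

/-- Row-major addressing: all blocks have length `m`, so entry `r` of block `i` is preceded by `i`
full blocks. What follows the blocks is irrelevant. -/
theorem getD_flatMap_finRange (f : Fin n → List ℕ) (h : ∀ i, (f i).length = m) (i : Fin n)
    {r : ℕ} (hr : r < m) (l : List ℕ) (d : ℕ) :
    ((List.finRange n).flatMap f ++ l).getD (i * m + r) d = (f i).getD r d := by
  induction n with
  | zero => exact i.elim0
  | succ n ih =>
    rw [List.finRange_succ, List.flatMap_cons, List.append_assoc]
    refine Fin.cases ?_ (fun i => ?_) i
    · rw [List.getD_append _ _ _ _ (by rw [h]; simpa using hr)]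
      simp
    · rw [List.getD_append_right _ _ _ _ (by rw [h]; simp [Nat.succ_mul]; omega), h,
        List.flatMap_map]
      rw [← ih (fun i => f i.succ) (fun i => h _) i]
      congr 1
      simp [Nat.succ_mul]
      omega

theorem getD_map_finRange (f : Fin n → ℕ) (i : Fin n) (l : List ℕ) (d : ℕ) :
    ((List.finRange n).map f ++ l).getD i d = f i := by
  rw [List.getD_append _ _ _ _ (by simp)]
  simp

/-- With positive factors no partial product exceeds the full one, so the cut-off never takes
effect. -/
theorem foldl_min_mul (c : ℕ) (l : List ℕ) (hl : ∀ k ∈ l, 0 < k) : ∀ x, x * l.prod ≤ c →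
    l.foldl (fun x k => min (x * k) c) x = x * l.prod := by
  induction l with
  | nil => simp
  | cons k l ih =>
    intro x hx
    have hp : 0 < l.prod := List.prod_pos fun a ha => hl a (by simp [ha])
    rw [List.prod_cons, ← mul_assoc] at hx
    have : x * k ≤ c := (Nat.le_mul_of_pos_right _ hp).trans hx
    rw [List.foldl_cons, min_eq_left this, ih (fun a ha => hl a (by simp [ha])) _ hx,
      List.prod_cons, mul_assoc]

end Lists

namespace NC1Instance

theorem bit_beq_one (p : Prop) : (bit p == 1) = true ↔ p := by
  by_cases h : p <;> simp [bit, h]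

theorem bit_le_one (p : Prop) : bit p ≤ 1 := by
  by_cases h : p <;> simp [bit, h]

variable (P : NC1Instance)

theorem numStates_pos : 0 < P.numStates := by
  obtain ⟨s, _⟩ := P.sys.initial_nonempty
  exact s.pos

theorem numActs_pos (i : Fin P.numAgents) : 0 < P.numActs i := by
  obtain ⟨a, _⟩ := P.sys.avail_nonempty i ⟨0, P.numStates_pos⟩
  exact a.pos

noncomputable def availTable : List ℕ :=
  (List.finRange P.numAgents).flatMap fun i => (List.finRange P.numStates).flatMap fun s =>
    (List.finRange (P.numActs i)).map fun a => bit (a ∈ P.sys.avail i s)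

def agentObsTable : List ℕ :=
  (List.finRange P.numAgents).flatMap fun i => (List.finRange P.numStates).map fun s =>
    (P.sys.obs i s : ℕ)

noncomputable def initialTable : List ℕ :=
  (List.finRange P.numStates).map fun s => bit (s ∈ P.sys.initial)

/-- The joint action with a given index. -/
def action (a : Fin P.numJoint) : ∀ i, Fin (P.numActs i) := finPiFinEquiv.symm a

noncomputable def transTable : List ℕ :=
  (List.finRange P.numStates).flatMap fun s => (List.finRange P.numJoint).flatMap fun a =>
    (List.finRange P.numStates).map fun s' => bit (P.sys.trans s (P.action a) s')

noncomputable def valTable : List ℕ :=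
  (List.finRange P.numStates).flatMap fun s => (List.finRange P.numProps).map fun p =>
    bit (p ∈ P.sys.val s)

def newObsTable : List ℕ := (List.finRange P.numStates).map fun s => (P.newObs s : ℕ)

noncomputable def disallowedTable (j : Fin (P.numOthers + 1)) : List ℕ :=
  (List.finRange P.numStates).flatMap fun s => (List.finRange (P.numNorms j)).flatMap fun q =>
    (List.finRange P.numJoint).map fun a => bit (P.action a ∈ (P.norms j).disallowed s q)

def updateTable (j : Fin (P.numOthers + 1)) : List ℕ :=
  (List.finRange (P.numNorms j)).flatMap fun q => (List.finRange P.numStates).map fun s =>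
    ((P.norms j).update q s : ℕ)

/-- All tables of an instance. -/
noncomputable def table : List ℕ :=
  P.sysTable ++ [P.numOthers] ++ (List.finRange (P.numOthers + 1)).flatMap P.normTable

/-- In this right-nested form every part of the data is reached by dropping prefixes of known
length. Joint actions are replaced by their indices. -/
theorem table_eq : P.table = P.numAgents :: (List.ofFn P.numActs ++
    (P.numStates :: P.numObs :: P.numProps :: (P.availTable ++ (P.agentObsTable ++
      (P.initialTable ++ (P.transTable ++ (P.valTable ++ (P.newObsTable ++ (P.numOthers ::
        (List.finRange (P.numOthers + 1)).flatMap P.normTable))))))))) := by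
  simp [table, sysTable, availTable, agentObsTable, initialTable, transTable, valTable,
    newObsTable, jointActions, List.flatMap_map, List.append_assoc, numJoint, action]

theorem normTable_eq (j : Fin (P.numOthers + 1)) : P.normTable j =
    P.numNorms j :: ((P.norms j).start : ℕ) :: (P.disallowedTable j ++ P.updateTable j) := by
  simp [normTable, disallowedTable, updateTable, jointActions, numJoint, action,
    Function.comp_def]

theorem length_availTable : P.availTable.length = P.numStates * (List.ofFn P.numActs).sum := by
  simp [availTable, List.length_flatMap, List.sum_ofFn, Finset.mul_sum, ← List.ofFn_eq_map]

theorem length_agentObsTable : P.agentObsTable.length = P.numAgents * P.numStates :=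
  length_flatMap_finRange _ fun _ => by simp

theorem length_initialTable : P.initialTable.length = P.numStates := by simp [initialTable]

theorem length_transTable :
    P.transTable.length = P.numStates * (P.numJoint * P.numStates) :=
  length_flatMap_finRange _ fun _ => length_flatMap_finRange _ fun _ => by simp

theorem length_valTable : P.valTable.length = P.numStates * P.numProps :=
  length_flatMap_finRange _ fun _ => by simp

theorem length_newObsTable : P.newObsTable.length = P.numStates := by simp [newObsTable]

theorem length_disallowedTable (j : Fin (P.numOthers + 1)) :
    (P.disallowedTable j).length = P.numStates * (P.numNorms j * P.numJoint) :=
  length_flatMap_finRange _ fun _ => length_flatMap_finRange _ fun _ => by simp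

theorem length_updateTable (j : Fin (P.numOthers + 1)) :
    (P.updateTable j).length = P.numNorms j * P.numStates :=
  length_flatMap_finRange _ fun _ => by simp

theorem agents_table : Table.agents P.table = P.numAgents := by
  rw [Table.agents, table_eq]; rfl

theorem acts_table : Table.acts P.table = List.ofFn P.numActs := by
  rw [Table.acts, agents_table, table_eq]
  refine List.ext_getElem (by simp) fun i h₁ h₂ => ?_
  rw [List.getElem_map, List.getElem_range, List.getD_cons_succ, List.getD_append _ _ _ _ h₂,
    List.getD_eq_getElem]

theorem sysPart_table : Table.sysPart P.table =
    P.numStates :: P.numObs :: P.numProps :: (P.availTable ++ (P.agentObsTable ++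
      (P.initialTable ++ (P.transTable ++ (P.valTable ++ (P.newObsTable ++ (P.numOthers ::
        (List.finRange (P.numOthers + 1)).flatMap P.normTable))))))) := by
  rw [Table.sysPart, agents_table, table_eq, List.drop_succ_cons, List.drop_left' (by simp)]

theorem states_table : Table.states P.table = P.numStates := by
  rw [Table.states, sysPart_table]; rfl

theorem props_table : Table.props P.table = P.numProps := by
  rw [Table.props, sysPart_table]; rfl

theorem joint_table : Table.joint P.table = P.numJoint := by
  have hp : (List.ofFn P.numActs).prod = P.numJoint := by rw [List.prod_ofFn, numJoint]
  rw [Table.joint, acts_table, foldl_min_mul, hp, one_mul]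
  · intro k hk
    obtain ⟨i, rfl⟩ := (List.mem_ofFn' _ _).1 hk
    exact P.numActs_pos i
  · rw [hp, one_mul, table_eq]
    -- The transition table alone has at least as many entries as there are joint actions, so the
    -- length of the list is a harmless cut-off.
    have h₁ := P.length_transTable
    have h₂ : P.numJoint ≤ P.numStates * (P.numJoint * P.numStates) :=
      (Nat.le_mul_of_pos_right _ P.numStates_pos).trans (Nat.le_mul_of_pos_left _ P.numStates_pos)
    simp
    omega

theorem initialPart_table : Table.initialPart P.table =
    P.initialTable ++ (P.transTable ++ (P.valTable ++ (P.newObsTable ++ (P.numOthers ::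
      (List.finRange (P.numOthers + 1)).flatMap P.normTable)))) := by
  rw [Table.initialPart, sysPart_table, states_table, acts_table, agents_table,
    ← List.drop_drop, ← List.drop_drop, List.drop_succ_cons, List.drop_succ_cons,
    List.drop_succ_cons, List.drop_zero, List.drop_left' P.length_availTable,
    List.drop_left' P.length_agentObsTable]

theorem transPart_table : Table.transPart P.table =
    P.transTable ++ (P.valTable ++ (P.newObsTable ++ (P.numOthers ::
      (List.finRange (P.numOthers + 1)).flatMap P.normTable))) := by
  rw [Table.transPart, initialPart_table, states_table, List.drop_left' P.length_initialTable]

theorem obsPart_table : Table.obsPart P.table = P.newObsTable ++ (P.numOthers ::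
      (List.finRange (P.numOthers + 1)).flatMap P.normTable) := by
  rw [Table.obsPart, transPart_table, states_table, joint_table, props_table,
    ← List.drop_drop, List.drop_left' P.length_transTable, List.drop_left' P.length_valTable]

theorem othersPart_table : Table.othersPart P.table = P.numOthers ::
      (List.finRange (P.numOthers + 1)).flatMap P.normTable := by
  rw [Table.othersPart, obsPart_table, states_table, List.drop_left' P.length_newObsTable]

theorem others_table : Table.others P.table = P.numOthers := by
  rw [Table.others, othersPart_table]; rfl

theorem initial_table (s : Fin P.numStates) :
    Table.initial P.table s = true ↔ s ∈ P.sys.initial := by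
  rw [Table.initial, initialPart_table, initialTable, getD_map_finRange, bit_beq_one]

theorem newObs_table (s : Fin P.numStates) : Table.newObs P.table s = P.newObs s := by
  rw [Table.newObs, obsPart_table, newObsTable, getD_map_finRange]

theorem index_lt {m n i j : ℕ} (hi : i < m) (hj : j < n) : i * n + j < m * n :=
  calc i * n + j < (i + 1) * n := by rw [Nat.add_mul]; omega
    _ ≤ m * n := Nat.mul_le_mul_right _ hi

theorem trans_table (s s' : Fin P.numStates) (a : Fin P.numJoint) :
    Table.trans P.table s a s' = true ↔ P.sys.trans s (P.action a) s' := by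
  rw [Table.trans, transPart_table, states_table, joint_table, transTable,
    getD_flatMap_finRange _ (fun _ => length_flatMap_finRange _ fun _ => by simp) _
      (index_lt a.2 s'.2),
    ← List.append_nil (List.flatMap _ _),
    getD_flatMap_finRange _ (fun _ => by simp) _ s'.2, ← List.append_nil (List.map _ _),
    getD_map_finRange, bit_beq_one]

theorem skipNorm_table (j : Fin (P.numOthers + 1)) (l : List ℕ) :
    Table.skipNorm P.table (P.normTable j ++ l) = l := by
  rw [Table.skipNorm, states_table, joint_table]
  refine List.drop_left' ?_
  rw [normTable_eq]
  simp [length_disallowedTable, length_updateTable]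
  omega

theorem normPart_table (j : Fin (P.numOthers + 1)) :
    ∃ l, Table.normPart P.table j = P.normTable j ++ l := by
  have h : ∀ i ≤ P.numOthers + 1, Table.normPart P.table i =
      ((List.finRange (P.numOthers + 1)).drop i).flatMap P.normTable := by
    intro i
    induction i with
    | zero => intro _; rw [Table.normPart, othersPart_table]; rfl
    | succ i ih =>
      intro hi
      have hi' := ih (by omega)
      rw [Table.normPart] at hi' ⊢
      rw [Function.iterate_succ_apply', hi', List.drop_eq_getElem_cons (by simp; omega),
        List.flatMap_cons, skipNorm_table]
  rw [h j (by omega), List.drop_eq_getElem_cons (by simp; omega), List.flatMap_cons]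
  exact ⟨_, by simp; rfl⟩

theorem norms_table (j : Fin (P.numOthers + 1)) : Table.norms P.table j = P.numNorms j := by
  obtain ⟨l, hl⟩ := P.normPart_table j
  rw [Table.norms, hl, normTable_eq]; rfl

theorem start_table (j : Fin (P.numOthers + 1)) :
    Table.start P.table j = (P.norms j).start := by
  obtain ⟨l, hl⟩ := P.normPart_table j
  rw [Table.start, hl, normTable_eq]; rfl

theorem disallowed_table (j : Fin (P.numOthers + 1)) (s : Fin P.numStates)
    (q : Fin (P.numNorms j)) (a : Fin P.numJoint) :
    Table.disallowed P.table j s q a = true ↔ P.action a ∈ (P.norms j).disallowed s q := by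
  obtain ⟨l, hl⟩ := P.normPart_table j
  rw [Table.disallowed, hl, norms_table, joint_table, normTable_eq, List.cons_append,
    List.cons_append, List.append_assoc, Nat.add_comm 2, List.getD_cons_succ,
    List.getD_cons_succ, disallowedTable,
    getD_flatMap_finRange _ (fun _ => length_flatMap_finRange _ fun _ => by simp) _
      (index_lt q.2 a.2),
    ← List.append_nil (List.flatMap _ _),
    getD_flatMap_finRange _ (fun _ => by simp) _ a.2, ← List.append_nil (List.map _ _),
    getD_map_finRange, bit_beq_one]

theorem update_table (j : Fin (P.numOthers + 1)) (q : Fin (P.numNorms j))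
    (s : Fin P.numStates) : Table.update P.table j q s = (P.norms j).update q s := by
  obtain ⟨l, hl⟩ := P.normPart_table j
  rw [Table.update, hl, norms_table, joint_table, states_table, normTable_eq, List.cons_append,
    List.cons_append, List.append_assoc, Nat.add_assoc, Nat.add_comm 2, List.getD_cons_succ,
    List.getD_cons_succ, List.getD_append_right _ _ _ _ (by rw [length_disallowedTable]; omega),
    length_disallowedTable, Nat.add_sub_cancel_left, updateTable,
    getD_flatMap_finRange _ (fun _ => by simp) _ s.2, ← List.append_nil (List.map _ _),
    getD_map_finRange]

end NC1Instance

end NormRecognition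

/-! ### Pairs with arbitrarily long paths, and correctness of the procedure -/

namespace NormRecognition

section Survivors

variable {V : Type} (E : V → V → Bool) (D : List V)

/-- A round that changes the list removes at least one member. Hence after as many rounds as there
were members the list is stable or empty, and the empty list is stable too. -/
theorem survivors_core :
    survivors E ((survivors E)^[D.length] D) = (survivors E)^[D.length] D := by
  have key : ∀ k, survivors E ((survivors E)^[k] D) = (survivors E)^[k] D ∨
      ((survivors E)^[k] D).length + k ≤ D.length := by
    intro k
    induction k with
    | zero => exact .inr le_rfl
    | succ k ih =>
      rw [Function.iterate_succ_apply']
      by_cases hk : survivors E ((survivors E)^[k] D) = (survivors E)^[k] D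
      · exact .inl (by rw [hk, hk])
      · have hs : (survivors E ((survivors E)^[k] D)).Sublist ((survivors E)^[k] D) :=
          List.filter_sublist
        have h₁ := ih.resolve_left hk
        have h₂ := lt_of_le_of_ne hs.length_le fun h => hk (hs.eq_of_length h)
        exact .inr (by omega)
  rcases key D.length with h | h
  · exact h
  · rw [List.eq_nil_of_length_eq_zero (by omega : ((survivors E)^[D.length] D).length = 0)]
    rfl

theorem mem_survivors {x : V} : x ∈ survivors E D ↔ x ∈ D ∧ ∃ y ∈ D, E x y = true := by
  simp [survivors]

end Survivors

namespace NC1Instance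

variable (P : NC1Instance) {j : Fin (P.numOthers + 1)}

/-- The numbers of an environment state and a normative state. -/
def pairVal {m n : ℕ} (w : Fin m × Fin n) : ℕ × ℕ := (w.1, w.2)

theorem isStart_table (w : Fin P.numStates × Fin (P.numNorms j)) :
    Table.isStart P.table j (pairVal w) = true ↔ w ∈ (P.norms j).kripke.initial := by
  simp only [Table.isStart, pairVal, start_table, Bool.and_eq_true, initial_table, beq_iff_eq,
    NormativeSystem.kripke, Set.mem_ofPred_eq, Fin.val_inj]

theorem edge_table (w w' : Fin P.numStates × Fin (P.numNorms j)) :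
    Table.edge P.table j (pairVal w) (pairVal w') = true ↔ (P.norms j).kripke.rel w w' := by
  simp only [Table.edge, pairVal, update_table, Bool.and_eq_true, beq_iff_eq, Fin.val_inj,
    NormativeSystem.kripke, List.any_eq_true, List.mem_range, joint_table]
  refine and_congr_left' ⟨?_, ?_⟩
  · rintro ⟨a, ha, h₁, h₂⟩
    rw [Bool.not_eq_true', ← Bool.not_eq_true] at h₂
    exact ⟨P.action ⟨a, ha⟩, (P.trans_table w.1 w'.1 ⟨a, ha⟩).1 h₁,
      fun h => h₂ ((P.disallowed_table j w.1 w.2 ⟨a, ha⟩).2 h)⟩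
  · rintro ⟨b, h₁, h₂⟩
    obtain ⟨a, rfl⟩ := finPiFinEquiv.symm.surjective b
    refine ⟨a, a.2, (P.trans_table w.1 w'.1 a).2 h₁, ?_⟩
    rw [Bool.not_eq_true', ← Bool.not_eq_true]
    exact fun h => h₂ ((P.disallowed_table j w.1 w.2 a).1 h)

theorem mem_worlds {x : ℕ × ℕ} : x ∈ Table.worlds P.table j ↔
    ∃ w : Fin P.numStates × Fin (P.numNorms j), pairVal w = x := by
  simp only [Table.worlds, states_table, norms_table, List.mem_flatMap, List.mem_range,
    List.mem_map, pairVal]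
  constructor
  · rintro ⟨s, hs, q, hq, rfl⟩
    exact ⟨(⟨s, hs⟩, ⟨q, hq⟩), rfl⟩
  · rintro ⟨w, rfl⟩
    exact ⟨w.1, w.1.2, w.2, w.2.2, rfl⟩

theorem mem_pairs {x : (ℕ × ℕ) × (ℕ × ℕ)} : x ∈ Table.pairs P.table j ↔
    ∃ (w : Fin P.numStates × Fin (P.numNorms 0)) (w' : Fin P.numStates × Fin (P.numNorms j)),
      (pairVal w, pairVal w') = x ∧ P.newObs w.1 = P.newObs w'.1 := by
  have h₀ : ∀ x, x ∈ Table.worlds P.table 0 ↔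
    ∃ w : Fin P.numStates × Fin (P.numNorms 0), pairVal w = x := fun x => P.mem_worlds (j := 0)
  simp only [Table.pairs, List.mem_filter, List.mem_flatMap, List.mem_map, h₀, mem_worlds]
  constructor
  · rintro ⟨⟨_, ⟨w, rfl⟩, _, ⟨w', rfl⟩, rfl⟩, h⟩
    simp only [pairVal, newObs_table, beq_iff_eq, Fin.val_inj] at h
    exact ⟨w, w', rfl, h⟩
  · rintro ⟨w, w', rfl, h⟩
    exact ⟨⟨_, ⟨w, rfl⟩, _, ⟨w', rfl⟩, rfl⟩, by simp [pairVal, newObs_table, h]⟩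

theorem pairEdge_table (w v : Fin P.numStates × Fin (P.numNorms 0))
    (w' v' : Fin P.numStates × Fin (P.numNorms j)) :
    Table.pairEdge P.table j (pairVal w, pairVal w') (pairVal v, pairVal v') = true ↔
      (P.norms 0).kripke.rel w v ∧ (P.norms j).kripke.rel w' v' := by
  rw [Table.pairEdge, Bool.and_eq_true]
  exact and_congr (P.edge_table (j := 0) w v) (P.edge_table w' v')

/-- A pair survives round `i + 1` because the next pair along the two paths has survived `i` rounds,
its own paths being shorter by just one step. -/
theorem mem_iterate_survivors (i : ℕ) : ∀ (ρ : List (Fin P.numStates × Fin (P.numNorms 0)))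
    (ρ' : List (Fin P.numStates × Fin (P.numNorms j))) (w w'),
    (w :: ρ).IsChain (P.norms 0).kripke.rel → (w' :: ρ').IsChain (P.norms j).kripke.rel →
    pathObs P.newObs (w :: ρ) = pathObs P.newObs (w' :: ρ') → i ≤ ρ.length →
    (pairVal w, pairVal w') ∈
      (survivors (Table.pairEdge P.table j))^[i] (Table.pairs P.table j) := by
  induction i with
  | zero =>
    intro ρ ρ' w w' _ _ h _
    exact P.mem_pairs.2 ⟨w, w', rfl, (List.cons_eq_cons.1 h).1⟩
  | succ i ih =>
    intro ρ ρ' w w' h₁ h₂ h hi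
    rw [Function.iterate_succ_apply', mem_survivors]
    refine ⟨ih ρ ρ' w w' h₁ h₂ h (by omega), ?_⟩
    have hl : ρ.length = ρ'.length := by simpa [pathObs] using congrArg List.length h
    obtain ⟨v, ρ, rfl⟩ := List.exists_cons_of_length_pos (by omega : 0 < ρ.length)
    obtain ⟨v', ρ', rfl⟩ := List.exists_cons_of_length_pos (by omega : 0 < ρ'.length)
    rw [List.isChain_cons_cons] at h₁ h₂
    exact ⟨_, ih ρ ρ' v v' h₁.2 h₂.2 (List.cons_eq_cons.1 h).2 (by simpa using hi),
      (P.pairEdge_table w v w' v').2 ⟨h₁.1, h₂.1⟩⟩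

theorem core_subset_pairs {x : (ℕ × ℕ) × (ℕ × ℕ)} (h : x ∈ Table.core P.table j) :
    x ∈ Table.pairs P.table j :=
  (Table.iterate_sublist (fun _ => List.filter_sublist) _ _).subset h

/-- The core is stable, so each of its pairs has a successor pair in the core, and paths can be
prolonged at will. Observations agree along them since the core consists of pairs with equal
observations. -/
theorem exists_paths_of_mem_core (i : ℕ) : ∀ (w : Fin P.numStates × Fin (P.numNorms 0))
    (w' : Fin P.numStates × Fin (P.numNorms j)),
    (pairVal w, pairVal w') ∈ Table.core P.table j → ∃ ρ ρ', ρ.length = i ∧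
      (w :: ρ).IsChain (P.norms 0).kripke.rel ∧ (w' :: ρ').IsChain (P.norms j).kripke.rel ∧
      pathObs P.newObs (w :: ρ) = pathObs P.newObs (w' :: ρ') := by
  have hinj : ∀ {m n : ℕ} {w v : Fin m × Fin n}, pairVal w = pairVal v → w = v := by
    intro m n w v h
    simpa [pairVal, Prod.ext_iff, Fin.val_inj] using h
  have hobs : ∀ (w : Fin P.numStates × Fin (P.numNorms 0))
      (w' : Fin P.numStates × Fin (P.numNorms j)), (pairVal w, pairVal w') ∈ Table.core P.table j →
      P.newObs w.1 = P.newObs w'.1 := by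
    intro w w' h
    obtain ⟨v, v', hv, hobs⟩ := P.mem_pairs.1 (P.core_subset_pairs h)
    rw [Prod.mk.injEq] at hv
    rwa [← hinj hv.1, ← hinj hv.2]
  induction i with
  | zero =>
    intro w w' h
    exact ⟨[], [], rfl, .singleton _, .singleton _, by simp [pathObs, hobs w w' h]⟩
  | succ i ih =>
    intro w w' h
    have hs := h
    rw [Table.core, ← survivors_core, mem_survivors] at hs
    obtain ⟨_, y, hy, he⟩ := hs
    obtain ⟨v, v', rfl, -⟩ := P.mem_pairs.1 (P.core_subset_pairs hy)
    obtain ⟨ρ, ρ', hl, h₁, h₂, h₃⟩ := ih v v' hy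
    rw [pairEdge_table] at he
    refine ⟨v :: ρ, v' :: ρ', by simp [hl], .cons_cons he.1 h₁, .cons_cons he.2 h₂, ?_⟩
    exact congrArg₂ List.cons (hobs w w' h) h₃

theorem decideNC1_table : Table.decideNC1 P.table = true ↔ NC1 P.newObs P.norms 0 := by
  simp only [Table.decideNC1, List.all_eq_true, List.mem_range, others_table, Table.recognized]
  constructor
  · intro h
    -- The sum dominates the number of rounds for every `j` at once. The additional `1` makes the
    -- paths nonempty and accounts for a path having one state more than it has steps.
    refine ⟨∑ j : Fin (P.numOthers + 1), (Table.pairs P.table j).length + 1, ?_⟩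
    rintro ρ ⟨hi, hc⟩ hk ⟨j, ρ'⟩ ⟨⟨hi', hc'⟩, ho⟩
    by_contra hj
    change j ≠ 0 at hj
    have hl : ρ'.length = ρ.length := by simpa [pathObs] using congrArg List.length ho
    obtain ⟨w, ρ, rfl⟩ := List.exists_cons_of_length_pos (by omega : 0 < ρ.length)
    obtain ⟨w', ρ', rfl⟩ := List.exists_cons_of_length_pos
      (by simp at hl; simp [hl] : 0 < ρ'.length)
    have hle : (Table.pairs P.table j).length ≤
        ∑ j : Fin (P.numOthers + 1), (Table.pairs P.table j).length :=
      Finset.single_le_sum (f := fun j : Fin (P.numOthers + 1) => (Table.pairs P.table j).length)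
        (fun _ _ => Nat.zero_le _) (Finset.mem_univ j)
    have hm := P.mem_iterate_survivors (Table.pairs P.table j).length ρ ρ' w w' hc hc' ho.symm
      (by simp at hk; omega)
    obtain ⟨i, rfl⟩ := Fin.exists_succ_eq.2 hj
    have hn := h i i.2 _ hm
    rw [Bool.not_eq_true', ← Bool.not_eq_true, Bool.and_eq_true] at hn
    exact hn ⟨(P.isStart_table (j := 0) w).2 (hi w (by simp)),
      (P.isStart_table (j := i.succ) w').2 (hi' w' (by simp))⟩
  · rintro ⟨k, hk⟩ i hi x hx
    rw [Bool.not_eq_true', ← Bool.not_eq_true, Bool.and_eq_true]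
    rintro ⟨h₁, h₂⟩
    obtain ⟨w, w', rfl, -⟩ := P.mem_pairs (j := Fin.succ ⟨i, hi⟩) |>.1 (P.core_subset_pairs hx)
    -- Paths of `k` steps from a pair of initial states in the core contradict the bound `k`.
    obtain ⟨ρ, ρ', hl, hc, hc', ho⟩ := P.exists_paths_of_mem_core (j := Fin.succ ⟨i, hi⟩) k w w' hx
    have hw := (P.isStart_table (j := 0) w).1 h₁
    have hw' := (P.isStart_table (j := Fin.succ ⟨i, hi⟩) w').1 h₂
    have h₀ := hk (w :: ρ) ⟨by simpa using hw, hc⟩ (by simp [hl])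
      ⟨Fin.succ ⟨i, hi⟩, w' :: ρ'⟩ ⟨⟨by simpa using hw', hc'⟩, ho.symm⟩
    exact Fin.succ_ne_zero (⟨i, hi⟩ : Fin P.numOthers) h₀

theorem decide_encode : Table.decideNC1 (decodeNats P.encode) = P.answer := by
  classical
  rw [show P.encode = encodeNats P.table from rfl, decodeNats_encodeNats, Bool.eq_iff_iff,
    decideNC1_table, answer, decide_eq_true_eq]

/-! ### The length of the encoding -/

theorem length_encodeNats_le {l : List ℕ} {b : ℕ} (h : ∀ x ∈ l, x ≤ b) :
    (encodeNats l).length ≤ l.length * (b + 1) := by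
  rw [encodeNats, List.length_flatMap]
  refine (List.sum_le_card_nsmul _ (b + 1) fun x hx => ?_).trans (by simp)
  obtain ⟨y, hy, rfl⟩ := List.mem_map.1 hx
  simpa using h y hy

/-- The size counts only joint actions. It still controls the local ones, because no factor of the
product is zero. -/
theorem numActs_le (i : Fin P.numAgents) : P.numActs i ≤ P.numJoint :=
  Finset.single_le_prod' (fun i _ => P.numActs_pos i) (Finset.mem_univ i)

theorem numNorms_le (j : Fin (P.numOthers + 1)) : P.numNorms j ≤ P.normsSize :=
  (Finset.single_le_sum (f := P.numNorms) (fun _ _ => Nat.zero_le _) (Finset.mem_univ j)).trans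
    (Nat.le_add_left _ _)

theorem length_normTables : ((List.finRange (P.numOthers + 1)).flatMap P.normTable).length =
    2 * (P.numOthers + 1) +
      (∑ j, P.numNorms j) * (P.numStates * P.numJoint + P.numStates) := by
  have h : ∀ j, (P.normTable j).length =
      2 + P.numNorms j * (P.numStates * P.numJoint + P.numStates) := by
    intro j
    simp only [normTable_eq, List.length_cons, List.length_append, length_disallowedTable,
      length_updateTable]
    ring
  rw [List.length_flatMap, ← List.ofFn_eq_map, List.sum_ofFn]
  simp only [h, Finset.sum_add_distrib, Finset.sum_const, Finset.card_univ, Fintype.card_fin,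
    smul_eq_mul, Finset.sum_mul]
  ring

/-- The cubic terms come from the available actions, the transitions and the disallowed actions; the
quadratic ones from the agents' observations, the valuation and the updates. The linear ones are the
numbers of local actions, the initial states, the new observations and two header entries per
normative system. -/
theorem length_table_le {z : ℕ} (h₁ : P.sysSize ≤ z) (h₂ : P.normsSize ≤ z) :
    P.table.length ≤ 5 + 5 * z + 3 * z ^ 2 + 3 * z ^ 3 := by
  have hsum : (List.ofFn P.numActs).sum ≤ P.numAgents * P.numJoint := by
    rw [List.sum_ofFn]
    exact (Finset.sum_le_card_nsmul _ _ _ fun i _ => P.numActs_le i).trans (by simp)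
  rw [sysSize] at h₁
  rw [normsSize] at h₂
  have hn : P.numStates ≤ z := by omega
  have hJ : P.numJoint ≤ z := by omega
  have ha : P.numAgents ≤ z := by omega
  have hp : P.numProps ≤ z := by omega
  have hq : ∑ j, P.numNorms j ≤ z := by omega
  have hm : P.numOthers + 1 ≤ z := by omega
  simp only [table_eq, List.length_cons, List.length_append, List.length_ofFn,
    length_availTable, length_agentObsTable, length_initialTable, length_transTable,
    length_valTable, length_newObsTable, length_normTables]
  have e₁ := Nat.mul_le_mul hn (hsum.trans (Nat.mul_le_mul ha hJ))
  have e₂ := Nat.mul_le_mul ha hn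
  have e₃ := Nat.mul_le_mul hn (Nat.mul_le_mul hJ hn)
  have e₄ := Nat.mul_le_mul hn hp
  have e₅ := Nat.mul_le_mul hq (Nat.add_le_add (Nat.mul_le_mul hn hJ) hn)
  ring_nf at e₁ e₂ e₃ e₄ e₅ ⊢
  omega

/-- Each entry is a bit, a cardinality bounded by the size, or an index below such a cardinality.
Bits are covered because there is at least one state. -/
theorem le_of_mem_table {x : ℕ} (hx : x ∈ P.table) : x ≤ P.sysSize + P.normsSize := by
  have hn := P.numStates_pos
  have hbit : ∀ p, bit p ≤ P.sysSize + P.normsSize := fun p =>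
    (bit_le_one p).trans (by rw [sysSize]; omega)
  rw [table_eq] at hx
  simp only [List.mem_cons, List.mem_append, availTable, agentObsTable, initialTable, transTable,
    valTable, newObsTable, List.mem_flatMap, List.mem_map, List.mem_finRange, true_and,
    normTable_eq, disallowedTable, updateTable] at hx
  rcases hx with rfl | hx | rfl | rfl | rfl | ⟨_, _, _, rfl⟩ | ⟨i, s, rfl⟩ | ⟨_, rfl⟩ |
    ⟨_, _, _, rfl⟩ | ⟨_, _, rfl⟩ | ⟨s, rfl⟩ | rfl | ⟨j, rfl | rfl | ⟨_, _, _, rfl⟩ | ⟨q, s, rfl⟩⟩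
  case inr.inl =>
    obtain ⟨i, rfl⟩ := (List.mem_ofFn' _ _).1 hx
    have := P.numActs_le i
    rw [sysSize]
    omega
  case inr.inr.inr.inr.inr.inr.inl =>
    have := (P.sys.obs i s).2
    rw [sysSize]
    omega
  case inr.inr.inr.inr.inr.inr.inr.inr.inr.inr.inl =>
    have := (P.newObs s).2
    rw [sysSize]
    omega
  case inr.inr.inr.inr.inr.inr.inr.inr.inr.inr.inr.inr.inl =>
    exact (P.numNorms_le j).trans (Nat.le_add_left _ _)
  case inr.inr.inr.inr.inr.inr.inr.inr.inr.inr.inr.inr.inr.inl =>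
    exact (((P.norms j).start.2.le).trans (P.numNorms_le j)).trans (Nat.le_add_left _ _)
  case inr.inr.inr.inr.inr.inr.inr.inr.inr.inr.inr.inr.inr.inr.inr =>
    exact ((((P.norms j).update q s).2.le).trans (P.numNorms_le j)).trans (Nat.le_add_left _ _)
  all_goals first | exact hbit _ | (rw [sysSize, normsSize]; omega)

end NC1Instance

end NormRecognition

theorem theorem2 :
    (∃ p : Polynomial ℕ, ∀ P : NormRecognition.NC1Instance,
      P.encode.length ≤ p.eval (P.sysSize + P.normsSize)) ∧
    Nonempty (Turing.TM2ComputableInPolyTime NormRecognition.NC1Instance.encode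
      Computability.encodeBool NormRecognition.NC1Instance.answer) := by
  -- The first factor bounds the number of entries, the second the unary length of an entry with its
  -- closing letter.
  refine ⟨⟨(5 + 5 * Polynomial.X + 3 * Polynomial.X ^ 2 + 3 * Polynomial.X ^ 3) *
    (Polynomial.X + 1), fun P => ?_⟩, ?_⟩
  · refine (NormRecognition.NC1Instance.length_encodeNats_le fun x hx =>
      P.le_of_mem_table hx).trans ?_
    simp only [Polynomial.eval_mul, Polynomial.eval_add, Polynomial.eval_pow, Polynomial.eval_X,
      Polynomial.eval_one, Polynomial.eval_ofNat]
    exact Nat.mul_le_mul_right _ (P.length_table_le (Nat.le_add_right _ _) (Nat.le_add_left _ _))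
  · exact StackProgram.PolyFun.polyTime
      (NormRecognition.Table.polyFun_decideNC1.comp NormRecognition.polyFun_decodeNats)
      fun P => P.decide_encode
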